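/- **Setting.** Let $h_1,h_2,h_3\in\mathbb R$. Let $S_1,S_2,\dots$ be i.i.d. uniform on $\{1,-1\}$ and let $N_{r,i},N_{d,i},N'_{d,i}$ be standard Gaussian, all independent. The relay observes $U_i=h_1S_i+N_{r,i}$ and the destination observes $X_i=h_3S_i+N_{d,i}$, $1\le i\le n$. The relay forwards $V^n$, drawn from an arbitrary conditional law $K_n(\cdot\mid U^n)$ (an *attack* is an arbitrary sequence $(K_n)_n$ of Markov kernels from $\mathbb R^n$ to $\mathbb R^n$; given $U^n$, $V^n$ is independent of all else), and the destination receives $Y_i=h_2V_i+N'_{d,i}$. Let $f_{U|X}(u|x)=\sum_{s=\pm1}P_{S|X}(s|x)\frac{1}{\sqrt{2\pi}}e^{-(u-h_1s)^2/2}$ with $P_{S|X}(s|x)=e^{-(x-h_3s)^2/2}/\sum_{s'=\pm1}e^{-(x-h_3s')^2/2}$, and $F_{Y|V}(y|v)=\int_{-\infty}^y\frac{1}{\sqrt{2\pi}}e^{-(t-h_2v)^2/2}\,dt$. The observation channel $(f_{U|X},F_{Y|V})$ is *manipulable* if there is a conditional law (Markov kernel) $\Psi(dv|u)$ on $\mathbb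 R$, not equal to $\delta_u(dv)$ for Lebesgue-almost every $u$, such that for all $x,y$ $$\int\!\!\int f_{U|X}(u|x)F_{Y|V}(y|v)\,\Psi(dv|u)\,du=\int f_{U|X}(u|x)F_{Y|V}(y|u)\,du ,$$ and *non-manipulable* otherwise. **Quantization.** The quantizer $(\alpha,\beta,N)$ has the $N$ cells $(-\infty,\alpha]$, the $N-2$ half-open intervals (closed on the right) of equal length $\frac{\beta-\alpha}{N-2}$ that partition $(\alpha,\beta]$, and $(\beta,\infty)$. At level $n'$, $U$ is quantized by $(\alpha_1,\beta_1,n')$ into cells $B^U_i$ and $V$ by $(\alpha_2,\beta_2,n_v)$ into cells $B^V_j$, with parameters depending on $n'$ such that, as $n'\to\infty$, $n_v\to\infty$, both cell lengths tend to $0$, $\alpha_2\to-\infty$, $\beta_2\to\infty$, and, for all large $n'$, $\alpha_1<\beta_1$, $\alpha_2<\beta_2$ and each $B^U_i$ is, for each $j$, either contained in or disjoint from $B^V_j$. Let $W_0(i,j)=1$ if $B^U_i\subseteq B^V_j$ and $0$ otherwise; let $\Delta F(j|i)=\#\{l\le n:U_l\in B_i^U,V_l\in B^V_j\}/\#\{l\le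 n:U_l\in B_i^U\}$ ($0$ if the denominator is $0$), and $$R_{n,n'}=\sum_{j=1}^{n_v}\sum_{i=1}^{n'}|\Delta F(j|i)-W_0(i,j)| .$$ **Theorem.** For all $h_1,h_2,h_3$ and every such family of quantizers, the observation channel is non-manipulable if and only if there are decision statistics $D^n=D^n(X^n,Y^n)$, measurable real functions not depending on the attack, $n'$ or $\delta$, and a function $\mu'(n',\delta)$ with $\mu'(n',\delta)\to0$ as $n'\to\infty,\ \delta\to0^+$, such that for every $\eta>0$ there is a function $\varepsilon(n',\delta)$ with values in $(0,\eta)$ for which the following holds: for all sufficiently small $\delta>0$ and $\epsilon>0$, for all sufficiently large $n'$ and for every attack, 1. if $\liminf_{n\to\infty}\Pr(R_{n,n'}>\delta)>0$, then $\lim_{n\to\infty}\Pr(D^n>\varepsilon(n',\delta)\mid R_{n,n'}>\delta)$ exists and is $\ge1-\epsilon$; 2. if $\liminf_{n\to\infty}\Pr(R_{n,n'}<\delta)>0$, then $\lim_{n\to\infty}\Pr(D^n>\mu'(n',\delta)\mid R_{n,n'}\le\delta)$ exists and is $\le\epsilon$. -/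

import Mathlib

open MeasureTheory ProbabilityTheory Filter Topology

noncomputable section

namespace RelayNetwork

/-! ### The observation channel -/

/-- Density of the relay's observation `U = h₁ S + N_r` given `S = s`. -/
def fUS (h₁ u s : ℝ) : ℝ := gaussianPDFReal (h₁ * s) 1 u

/-- Posterior probability of the symbol `s ∈ {1, -1}` given `X = x`, for `X = h₃ S + N_d` and
`S` equiprobable on `{1, -1}`. -/
def pSX (h₃ s x : ℝ) : ℝ :=
  Real.exp (-(x - h₃ * s) ^ 2 / 2) /
    (Real.exp (-(x - h₃ * 1) ^ 2 / 2) + Real.exp (-(x - h₃ * (-1)) ^ 2 / 2))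

/-- Conditional density `f_{U|X}(u|x)`. -/
def fUX (h₁ h₃ u x : ℝ) : ℝ :=
  pSX h₃ 1 x * fUS h₁ u 1 + pSX h₃ (-1) x * fUS h₁ u (-1)

/-- Conditional distribution function `F_{Y|V}(y|v)` for `Y = h₂ V + N_d'`. -/
def FYV (h₂ y v : ℝ) : ℝ := ∫ t in Set.Iic y, gaussianPDFReal (h₂ * v) 1 t

/-- The observation channel is manipulable if some conditional law `Ψ(dv|u)` that is not the
identity law `δ_u(dv)` (up to a Lebesgue-null set of `u`) gives the same law of `Y` given `X`
as faithful forwarding. Conditional laws are Markov kernels, since the identity itself is an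
impulse and the relay's output may be discrete or continuous. -/
def Manipulable (h₁ h₂ h₃ : ℝ) : Prop :=
  ∃ Ψ : Kernel ℝ ℝ, IsMarkovKernel Ψ ∧
    (¬ ∀ᵐ u ∂(volume : Measure ℝ), Ψ u = Measure.dirac u) ∧
    ∀ x y : ℝ, ∫ u, fUX h₁ h₃ u x * (∫ v, FYV h₂ y v ∂(Ψ u)) = ∫ u, fUX h₁ h₃ u x * FYV h₂ y u

/-- The observation channel is non-manipulable. -/
def NonManipulable (h₁ h₂ h₃ : ℝ) : Prop := ¬ Manipulable h₁ h₂ h₃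

/-! ### Quantization -/

/-- Width of the bounded cells of the quantizer with parameters `(α, β, N)`. -/
def step (α β : ℝ) (N : ℕ) : ℝ := (β - α) / ((N : ℝ) - 2)

/-- The `N` cells of the quantizer `(α, β, N)`, numbered from `0`: the half-line `(-∞, α]`, then
`N - 2` half-open intervals of equal width from `α` to `β`, then `(β, ∞)`. -/
def cell (α β : ℝ) (N : ℕ) (j : Fin N) : Set ℝ :=
  if j.val = 0 then Set.Iic α
  else if j.val + 1 = N then Set.Ioi β
  else Set.Ioc (α + ((j.val : ℝ) - 1) * step α β N) (α + (j.val : ℝ) * step α β N)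

/-- A family of quantizers indexed by the level `n'`: at level `n'` the relay's input is quantized
according to `(α₁ n', β₁ n', n')` and its output according to `(α₂ n', β₂ n', nv n')`. For large
levels each input cell is contained in one output cell; the mesh tends to `0` and the quantized
range exhausts the line (by nestedness also for the input). -/
structure QuantScheme where
  α₁ : ℕ → ℝ
  β₁ : ℕ → ℝ
  α₂ : ℕ → ℝ
  β₂ : ℕ → ℝ
  nv : ℕ → ℕ
  lt₁ : ∀ᶠ n' in atTop, α₁ n' < β₁ n'
  lt₂ : ∀ᶠ n' in atTop, α₂ n' < β₂ n'
  tendsto_nv : Tendsto nv atTop atTop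
  tendsto_step₁ : Tendsto (fun n' => step (α₁ n') (β₁ n') n') atTop (𝓝 0)
  tendsto_step₂ : Tendsto (fun n' => step (α₂ n') (β₂ n') (nv n')) atTop (𝓝 0)
  tendsto_α₂ : Tendsto α₂ atTop atBot
  tendsto_β₂ : Tendsto β₂ atTop atTop
  nested : ∀ᶠ n' in atTop, ∀ (i : Fin n') (j : Fin (nv n')),
    cell (α₁ n') (β₁ n') n' i ⊆ cell (α₂ n') (β₂ n') (nv n') j ∨
      Disjoint (cell (α₁ n') (β₁ n') n' i) (cell (α₂ n') (β₂ n') (nv n') j)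

namespace QuantScheme

/-- Input cells at level `n'`. -/
def cellU (Q : QuantScheme) (n' : ℕ) (i : Fin n') : Set ℝ := cell (Q.α₁ n') (Q.β₁ n') n' i

/-- Output cells at level `n'`. -/
def cellV (Q : QuantScheme) (n' : ℕ) (j : Fin (Q.nv n')) : Set ℝ :=
  cell (Q.α₂ n') (Q.β₂ n') (Q.nv n') j

end QuantScheme

/-- Sequences of `n` real symbols. -/
abbrev Seq (n : ℕ) : Type := Fin n → ℝ

/-- Number of symbols of the sequence `u` in the set `B`. -/
def count {n : ℕ} (B : Set ℝ) (u : Seq n) : ℝ := ∑ l, B.indicator (fun _ => (1 : ℝ)) (u l)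

open Classical in
/-- Empirical transition probability from input cell `i` to output cell `j`, and `0` if the input
cell is not visited. -/
def empKernel (Q : QuantScheme) (n' : ℕ) {n : ℕ} (u v : Seq n)
    (i : Fin n') (j : Fin (Q.nv n')) : ℝ :=
  if count (Q.cellU n' i) u = 0 then 0
  else (∑ l, (Q.cellV n' j).indicator (fun _ => (1 : ℝ)) (v l) *
      (Q.cellU n' i).indicator (fun _ => (1 : ℝ)) (u l)) / count (Q.cellU n' i) u

open Classical in
/-- The quantized identity kernel `W₀`. -/
def idKernel (Q : QuantScheme) (n' : ℕ) (i : Fin n') (j : Fin (Q.nv n')) : ℝ :=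
  if Q.cellU n' i ⊆ Q.cellV n' j then 1 else 0

/-- The sum of absolute differences between the empirical kernel and the identity kernel. -/
def deviation (Q : QuantScheme) (n' : ℕ) {n : ℕ} (u v : Seq n) : ℝ :=
  ∑ j : Fin (Q.nv n'), ∑ i : Fin n', |empKernel Q n' u v i j - idKernel Q n' i j|

/-! ### The network -/

/-- The equiprobable law on `{1, -1}`. -/
def symbolLaw : Measure ℝ :=
  (2⁻¹ : ENNReal) • (Measure.dirac (1 : ℝ) + Measure.dirac (-1 : ℝ))

/-- Symbols and noises: `(S, N_r, N_d, N_d')`, each a sequence of length `n`. -/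
abbrev Primitive (n : ℕ) : Type := Seq n × Seq n × Seq n × Seq n

/-- All symbols and noises are independent; symbols are equiprobable, noises standard normal. -/
def primitiveLaw (n : ℕ) : Measure (Primitive n) :=
  (Measure.pi fun _ => symbolLaw).prod
    ((Measure.pi fun _ => gaussianReal 0 1).prod
      ((Measure.pi fun _ => gaussianReal 0 1).prod (Measure.pi fun _ => gaussianReal 0 1)))

/-- The relay's observation `U = h₁ S + N_r`. -/
def relayInput (h₁ : ℝ) {n : ℕ} (w : Primitive n) : Seq n := fun l => h₁ * w.1 l + w.2.1 l

lemma measurable_relayInput (h₁ : ℝ) (n : ℕ) :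
    Measurable (relayInput h₁ : Primitive n → Seq n) := by
  unfold relayInput
  fun_prop

/-- Law of the primitives together with the relay's output `V`, when the relay uses the attack `K`,
an arbitrary conditional law of the output sequence given the input sequence. The output depends on
the primitives only through the relay's input. -/
def networkLaw (h₁ : ℝ) {n : ℕ} (K : Kernel (Seq n) (Seq n)) : Measure (Primitive n × Seq n) :=
  primitiveLaw n ⊗ₘ K.comap (relayInput h₁) (measurable_relayInput h₁ n)

/-- `U` as a random sequence on the sample space of the network. -/
def seqU (h₁ : ℝ) {n : ℕ} (ω : Primitive n × Seq n) : Seq n := relayInput h₁ ω.1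

/-- `V`, the sequence forwarded by the relay. -/
def seqV {n : ℕ} (ω : Primitive n × Seq n) : Seq n := ω.2

/-- `X = h₃ S + N_d`, received by the destination from the source. -/
def seqX (h₃ : ℝ) {n : ℕ} (ω : Primitive n × Seq n) : Seq n :=
  fun l => h₃ * ω.1.1 l + ω.1.2.2.1 l

/-- `Y = h₂ V + N_d'`, received by the destination from the relay. -/
def seqY (h₂ : ℝ) {n : ℕ} (ω : Primitive n × Seq n) : Seq n :=
  fun l => h₂ * seqV ω l + ω.1.2.2.2 l

/-- The random deviation of the relay's empirical kernel from the identity kernel. -/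
def R (Q : QuantScheme) (h₁ : ℝ) (n' : ℕ) {n : ℕ} (ω : Primitive n × Seq n) : ℝ :=
  deviation Q n' (seqU h₁ ω) (seqV ω)

end RelayNetwork

end

/-!
Non-manipulability means that none of `h₁`, `h₂`, `h₃` vanishes. Since `E[S | U = u] = tanh (h₁ u)`,
the conditional mean of `(1 - S) 1{Y ≤ h₁ / h₂} - (1 + S) 1{Y ≤ -h₁ / h₂}` given `(U, V) = (u, v)`
can be written down, and for fixed `u ≠ v` it differs from its value at `v = u` by a quantity of
constant sign: up to this sign, its derivative in `v` is a positive multiple of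
`h₁ sinh (h₁ (v - u))`. Integrating over `v` excludes manipulation. Replacing `S` by its unbiased
estimate `X / h₃`, one obtains a statistic that, whatever the attack, estimates the empirical mean
of this gap. That mean is small if the empirical kernel is close to the identity and is bounded
below otherwise, because few inputs lie close to the boundary of a cell.

If `h₁`, `h₂` or `h₃` vanishes, forwarding `-U` instead of `U` leaves the law of what the
destination receives unchanged, which is a manipulation and defeats every statistic.
-/

noncomputable section

namespace RelayNetwork

/-! ### The gap of an observation channel -/

lemma cdf_gaussianReal_eq_integral (m y : ℝ) :
    cdf (gaussianReal m 1) y = ∫ t in Set.Iic y, gaussianPDFReal m 1 t := by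
  rw [cdf_eq_real, measureReal_def, gaussianReal_apply_eq_integral m one_ne_zero,
    ENNReal.toReal_ofReal (integral_nonneg fun t => gaussianPDFReal_nonneg m 1 t)]

lemma cdf_gaussianReal_sub (m y : ℝ) :
    cdf (gaussianReal m 1) y = cdf (gaussianReal 0 1) (y - m) := by
  have hmap : (gaussianReal 0 1).map (· + m) = gaussianReal m 1 := by
    rw [gaussianReal_map_add_const, zero_add]
  rw [cdf_eq_real, cdf_eq_real, ← hmap,
    map_measureReal_apply (measurable_add_const m) measurableSet_Iic, Set.preimage_add_const_Iic]

lemma hasDerivAt_cdf_gaussianReal (m y : ℝ) :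
    HasDerivAt (cdf (gaussianReal m 1)) (gaussianPDFReal m 1 y) y := by
  have hint : ∀ s, IntegrableOn (gaussianPDFReal m 1) s := fun s =>
    (integrable_gaussianPDFReal m 1).integrableOn
  have hcont : Continuous (gaussianPDFReal m 1) := by
    unfold gaussianPDFReal
    fun_prop
  have hcdf : ⇑(cdf (gaussianReal m 1)) =
      fun z => (∫ t in (0 : ℝ)..z, gaussianPDFReal m 1 t) + cdf (gaussianReal m 1) 0 := by
    funext z
    rw [cdf_gaussianReal_eq_integral, cdf_gaussianReal_eq_integral,
      ← intervalIntegral.integral_Iic_sub_Iic (hint _) (hint _), sub_add_cancel]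
  rw [hcdf]
  exact (intervalIntegral.integral_hasDerivAt_right (hcont.intervalIntegrable 0 y)
    (hcont.stronglyMeasurableAtFilter _ _) hcont.continuousAt).add_const _

lemma gaussianPDFReal_std_le_one (z : ℝ) : gaussianPDFReal 0 1 z ≤ 1 := by
  have hnorm : (√(2 * Real.pi * (1 : NNReal)))⁻¹ ≤ 1 := by
    refine inv_le_one_of_one_le₀ (Real.one_le_sqrt.2 ?_)
    push_cast
    linarith [Real.pi_gt_three]
  have hexp : Real.exp (-(z - 0) ^ 2 / (2 * (1 : NNReal))) ≤ 1 := by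
    rw [Real.exp_le_one_iff]
    push_cast
    nlinarith [sq_nonneg (z - 0)]
  exact mul_le_one₀ hnorm (Real.exp_nonneg _) hexp

lemma FYV_eq_cdf (h₂ y v : ℝ) : FYV h₂ y v = cdf (gaussianReal (h₂ * v) 1) y :=
  (cdf_gaussianReal_eq_integral _ _).symm

lemma FYV_nonneg (h₂ y v : ℝ) : 0 ≤ FYV h₂ y v := by
  rw [FYV_eq_cdf]
  exact cdf_nonneg _ _

lemma FYV_le_one (h₂ y v : ℝ) : FYV h₂ y v ≤ 1 := by
  rw [FYV_eq_cdf]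
  exact cdf_le_one _ _

lemma hasDerivAt_FYV (h₂ y v : ℝ) :
    HasDerivAt (FYV h₂ y) (-h₂ * gaussianPDFReal 0 1 (y - h₂ * v)) v := by
  have hFYV : FYV h₂ y = fun v => cdf (gaussianReal 0 1) (y - h₂ * v) := funext fun v => by
    rw [FYV_eq_cdf, cdf_gaussianReal_sub]
  have hinner : HasDerivAt (fun v => y - h₂ * v) (-h₂) v := by
    simpa using ((hasDerivAt_id v).const_mul h₂).const_sub y
  rw [hFYV, mul_comm]
  exact (hasDerivAt_cdf_gaussianReal 0 (y - h₂ * v)).comp v hinner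

@[fun_prop]
lemma continuous_FYV (h₂ y : ℝ) : Continuous (FYV h₂ y) :=
  continuous_iff_continuousAt.2 fun v => (hasDerivAt_FYV h₂ y v).continuousAt

@[fun_prop]
lemma measurable_FYV (h₂ y : ℝ) : Measurable (FYV h₂ y) := (continuous_FYV h₂ y).measurable

lemma abs_FYV_sub_le_one (h₂ y u v : ℝ) : |FYV h₂ y v - FYV h₂ y u| ≤ 1 :=
  abs_sub_le_of_nonneg_of_le (FYV_nonneg _ _ _) (FYV_le_one _ _ _) (FYV_nonneg _ _ _)
    (FYV_le_one _ _ _)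

lemma abs_FYV_sub_le (h₂ y u v : ℝ) : |FYV h₂ y v - FYV h₂ y u| ≤ |h₂| * |v - u| := by
  refine Convex.norm_image_sub_le_of_norm_hasDerivWithin_le (f := FYV h₂ y)
    (fun w _ => (hasDerivAt_FYV h₂ y w).hasDerivWithinAt) (fun w _ => ?_) convex_univ
    (Set.mem_univ u) (Set.mem_univ v)
  rw [Real.norm_eq_abs, abs_mul, abs_neg, abs_of_nonneg (gaussianPDFReal_nonneg _ _ _)]
  exact mul_le_of_le_one_right (abs_nonneg _) (gaussianPDFReal_std_le_one _)

@[fun_prop]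
lemma continuous_tanh : Continuous Real.tanh := by
  rw [funext Real.tanh_eq_sinh_div_cosh]
  exact Real.continuous_sinh.div Real.continuous_cosh fun x => (Real.cosh_pos x).ne'

@[fun_prop]
lemma measurable_tanh : Measurable Real.tanh := continuous_tanh.measurable

lemma one_sub_tanh (x : ℝ) : 1 - Real.tanh x = Real.exp (-x) / Real.cosh x := by
  have := (Real.cosh_pos x).ne'
  rw [Real.tanh_eq_sinh_div_cosh, ← Real.cosh_sub_sinh]
  field_simp

lemma one_add_tanh (x : ℝ) : 1 + Real.tanh x = Real.exp x / Real.cosh x := by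
  have := (Real.cosh_pos x).ne'
  rw [Real.tanh_eq_sinh_div_cosh, ← Real.cosh_add_sinh]
  field_simp

/-- The conditional mean of `(1 - S) 1{Y ≤ h₁ / h₂} - (1 + S) 1{Y ≤ -h₁ / h₂}` given `U = u` and
`V = v`; recall that `E[S | U = u] = tanh (h₁ u)`. -/
def regression (h₁ h₂ u v : ℝ) : ℝ :=
  (1 - Real.tanh (h₁ * u)) * FYV h₂ (h₁ / h₂) v -
    (1 + Real.tanh (h₁ * u)) * FYV h₂ (-(h₁ / h₂)) v

/-- The amount by which forwarding `v` instead of `u` changes `regression`, with the sign that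
makes it nonnegative. -/
def gap (h₁ h₂ u v : ℝ) : ℝ := -(h₁ * h₂) * (regression h₁ h₂ u v - regression h₁ h₂ u u)

lemma gap_self (h₁ h₂ u : ℝ) : gap h₁ h₂ u u = 0 := by
  rw [gap, sub_self, mul_zero]

lemma continuous_regression_self (h₁ h₂ : ℝ) : Continuous fun u => regression h₁ h₂ u u := by
  unfold regression
  fun_prop

lemma continuous_gap (h₁ h₂ : ℝ) : Continuous fun p : ℝ × ℝ => gap h₁ h₂ p.1 p.2 := by
  unfold gap regression
  fun_prop

lemma abs_regression_le (h₁ h₂ u v : ℝ) : |regression h₁ h₂ u v| ≤ 2 := by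
  have ht := abs_lt.1 (Real.abs_tanh_lt_one (h₁ * u))
  have hp : |(1 - Real.tanh (h₁ * u)) * FYV h₂ (h₁ / h₂) v| ≤ 1 - Real.tanh (h₁ * u) := by
    rw [abs_of_nonneg (mul_nonneg (by linarith) (FYV_nonneg _ _ _))]
    exact mul_le_of_le_one_right (by linarith) (FYV_le_one _ _ _)
  have hm : |(1 + Real.tanh (h₁ * u)) * FYV h₂ (-(h₁ / h₂)) v| ≤ 1 + Real.tanh (h₁ * u) := by
    rw [abs_of_nonneg (mul_nonneg (by linarith) (FYV_nonneg _ _ _))]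
    exact mul_le_of_le_one_right (by linarith) (FYV_le_one _ _ _)
  calc |regression h₁ h₂ u v| ≤ _ := abs_sub _ _
    _ ≤ 2 := by linarith

lemma gap_le_of_abs_FYV_sub_le {h₁ h₂ u v C : ℝ} (hC : ∀ y, |FYV h₂ y v - FYV h₂ y u| ≤ C) :
    gap h₁ h₂ u v ≤ 2 * |h₁ * h₂| * C := by
  have ht := abs_lt.1 (Real.abs_tanh_lt_one (h₁ * u))
  have hsub : |regression h₁ h₂ u v - regression h₁ h₂ u u| ≤ 2 * C :=
    calc |regression h₁ h₂ u v - regression h₁ h₂ u u|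
        = |(1 - Real.tanh (h₁ * u)) * (FYV h₂ (h₁ / h₂) v - FYV h₂ (h₁ / h₂) u) -
            (1 + Real.tanh (h₁ * u)) * (FYV h₂ (-(h₁ / h₂)) v - FYV h₂ (-(h₁ / h₂)) u)| := by
          congr 1
          unfold regression
          ring
      _ ≤ (1 - Real.tanh (h₁ * u)) * C + (1 + Real.tanh (h₁ * u)) * C := by
          refine (abs_sub _ _).trans (add_le_add ?_ ?_) <;>
            rw [abs_mul, abs_of_pos (by linarith)] <;>
            exact mul_le_mul_of_nonneg_left (hC _) (by linarith)
      _ = 2 * C := by ring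
  calc gap h₁ h₂ u v ≤ |gap h₁ h₂ u v| := le_abs_self _
    _ = |h₁ * h₂| * |regression h₁ h₂ u v - regression h₁ h₂ u u| := by rw [gap, abs_mul, abs_neg]
    _ ≤ |h₁ * h₂| * (2 * C) := mul_le_mul_of_nonneg_left hsub (abs_nonneg _)
    _ = 2 * |h₁ * h₂| * C := by ring

lemma gap_le_two_mul (h₁ h₂ u v : ℝ) : gap h₁ h₂ u v ≤ 2 * |h₁ * h₂| := by
  simpa using gap_le_of_abs_FYV_sub_le (h₁ := h₁) fun y => abs_FYV_sub_le_one h₂ y u v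

lemma gap_le_mul_abs_sub (h₁ h₂ u v : ℝ) :
    gap h₁ h₂ u v ≤ 2 * |h₁ * h₂| * (|h₂| * |v - u|) :=
  gap_le_of_abs_FYV_sub_le fun y => abs_FYV_sub_le h₂ y u v

section GapPositivity

variable {h₁ h₂ : ℝ}

lemma gaussianPDFReal_div_sub (hh₂ : h₂ ≠ 0) (v : ℝ) :
    gaussianPDFReal 0 1 (h₁ / h₂ - h₂ * v) =
      gaussianPDFReal 0 1 (h₂ * v) * Real.exp (-(h₁ / h₂) ^ 2 / 2) * Real.exp (h₁ * v) := by
  simp only [gaussianPDFReal, mul_assoc, ← Real.exp_add]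
  congr 2
  push_cast
  field_simp
  ring

-- The thresholds `±h₁ / h₂` are those for which the two Gaussian weights differ by the factor
-- `exp (2 h₁ v)`, while the two prefactors of `regression` differ by `exp (-2 h₁ u)`.
lemma hasDerivAt_gap (hh₂ : h₂ ≠ 0) (u v : ℝ) :
    HasDerivAt (gap h₁ h₂ u)
      (2 * h₂ ^ 2 * (gaussianPDFReal 0 1 (h₂ * v) * Real.exp (-(h₁ / h₂) ^ 2 / 2)) /
        Real.cosh (h₁ * u) * (h₁ * Real.sinh (h₁ * (v - u)))) v := by
  have hp := gaussianPDFReal_div_sub (h₁ := h₁) hh₂ v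
  have hm := gaussianPDFReal_div_sub (h₁ := -h₁) hh₂ v
  rw [neg_div, neg_sq] at hm
  have hderiv := ((((hasDerivAt_FYV h₂ (h₁ / h₂) v).const_mul (1 - Real.tanh (h₁ * u))).sub
    ((hasDerivAt_FYV h₂ (-(h₁ / h₂)) v).const_mul (1 + Real.tanh (h₁ * u)))).sub_const
    (regression h₁ h₂ u u)).const_mul (-(h₁ * h₂))
  have hcosh := (Real.cosh_pos (h₁ * u)).ne'
  refine hderiv.congr_deriv ?_
  rw [hp, hm, one_sub_tanh, one_add_tanh, Real.sinh_eq,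
    show h₁ * (v - u) = -(h₁ * u) + h₁ * v by ring,
    show -(-(h₁ * u) + h₁ * v) = h₁ * u + -h₁ * v by ring, Real.exp_add, Real.exp_add]
  field_simp
  ring

lemma mul_sinh_mul_pos {h x : ℝ} (hh : h ≠ 0) (hx : 0 < x) : 0 < h * Real.sinh (h * x) := by
  rcases hh.lt_or_gt with h_neg | h_pos
  · exact mul_pos_of_neg_of_neg h_neg (Real.sinh_neg_iff.2 (mul_neg_of_neg_of_pos h_neg hx))
  · exact mul_pos h_pos (Real.sinh_pos_iff.2 (mul_pos h_pos hx))

lemma gap_deriv_factor_pos (hh₂ : h₂ ≠ 0) (u v : ℝ) :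
    0 < 2 * h₂ ^ 2 * (gaussianPDFReal 0 1 (h₂ * v) * Real.exp (-(h₁ / h₂) ^ 2 / 2)) /
        Real.cosh (h₁ * u) := by
  have := gaussianPDFReal_pos 0 1 (h₂ * v) one_ne_zero
  have := Real.cosh_pos (h₁ * u)
  positivity

lemma strictMonoOn_gap (hh₁ : h₁ ≠ 0) (hh₂ : h₂ ≠ 0) (u : ℝ) :
    StrictMonoOn (gap h₁ h₂ u) (Set.Ici u) := by
  refine strictMonoOn_of_deriv_pos (convex_Ici u)
    (fun v _ => (hasDerivAt_gap hh₂ u v).continuousAt.continuousWithinAt) fun v hv => ?_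
  rw [interior_Ici, Set.mem_Ioi] at hv
  rw [(hasDerivAt_gap hh₂ u v).deriv]
  exact mul_pos (gap_deriv_factor_pos hh₂ u v) (mul_sinh_mul_pos hh₁ (sub_pos.2 hv))

lemma strictAntiOn_gap (hh₁ : h₁ ≠ 0) (hh₂ : h₂ ≠ 0) (u : ℝ) :
    StrictAntiOn (gap h₁ h₂ u) (Set.Iic u) := by
  refine strictAntiOn_of_deriv_neg (convex_Iic u)
    (fun v _ => (hasDerivAt_gap hh₂ u v).continuousAt.continuousWithinAt) fun v hv => ?_
  rw [interior_Iic, Set.mem_Iio] at hv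
  have hpos := mul_sinh_mul_pos hh₁ (sub_pos.2 hv)
  rw [← neg_sub v u, mul_neg, Real.sinh_neg, mul_neg, neg_pos] at hpos
  rw [(hasDerivAt_gap hh₂ u v).deriv]
  exact mul_neg_of_pos_of_neg (gap_deriv_factor_pos hh₂ u v) hpos

lemma gap_pos (hh₁ : h₁ ≠ 0) (hh₂ : h₂ ≠ 0) {u v : ℝ} (hvu : v ≠ u) : 0 < gap h₁ h₂ u v := by
  rw [← gap_self h₁ h₂ u]
  rcases hvu.lt_or_gt with hlt | hgt
  · exact strictAntiOn_gap hh₁ hh₂ u hlt.le Set.self_mem_Iic hlt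
  · exact strictMonoOn_gap hh₁ hh₂ u Set.self_mem_Ici hgt.le hgt

lemma gap_nonneg (hh₁ : h₁ ≠ 0) (hh₂ : h₂ ≠ 0) (u v : ℝ) : 0 ≤ gap h₁ h₂ u v := by
  rcases eq_or_ne v u with rfl | hvu
  · rw [gap_self]
  · exact (gap_pos hh₁ hh₂ hvu).le

lemma min_gap_le (hh₁ : h₁ ≠ 0) (hh₂ : h₂ ≠ 0) {u v ρ : ℝ} (hρ : 0 ≤ ρ) (hdist : ρ ≤ |u - v|) :
    min (gap h₁ h₂ u (u + ρ)) (gap h₁ h₂ u (u - ρ)) ≤ gap h₁ h₂ u v := by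
  rcases le_total u v with huv | hvu
  · rw [abs_of_nonpos (by linarith)] at hdist
    exact (min_le_left _ _).trans ((strictMonoOn_gap hh₁ hh₂ u).monotoneOn
      (by simpa using hρ) huv (by linarith))
  · rw [abs_of_nonneg (by linarith)] at hdist
    exact (min_le_right _ _).trans ((strictAntiOn_gap hh₁ hh₂ u).antitoneOn hvu
      (by simpa using hρ) (by linarith))

end GapPositivity

/-! ### Product measures -/

section Pi

variable {ι : Type*} [Fintype ι] {E : ι → Type*} [∀ i, MeasurableSpace (E i)]
  {μ : ∀ i, Measure (E i)} [∀ i, IsProbabilityMeasure (μ i)]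

lemma lintegral_pi_prod {f : ∀ i, E i → ENNReal} (hf : ∀ i, Measurable (f i)) :
    ∫⁻ x, ∏ i, f i (x i) ∂(Measure.pi μ) = ∏ i, ∫⁻ x, f i x ∂(μ i) := by
  have hindep := lintegral_prod_eq_prod_lintegral_of_indepFun (μ := Measure.pi μ) Finset.univ
    (fun i x => f i (x i)) (iIndepFun_pi fun i => (hf i).aemeasurable)
    (fun i => (hf i).comp (measurable_pi_apply i))
  rw [hindep]
  exact Finset.prod_congr rfl fun i _ => (measurePreserving_eval μ i).lintegral_comp (hf i)

lemma pi_withDensity {f : ∀ i, E i → ENNReal} (hf : ∀ i, Measurable (f i))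
    [∀ i, SigmaFinite ((μ i).withDensity (f i))] :
    Measure.pi (fun i => (μ i).withDensity (f i)) =
      (Measure.pi μ).withDensity fun x => ∏ i, f i (x i) := by
  refine Measure.pi_eq fun s hs => ?_
  rw [withDensity_apply _ (MeasurableSet.univ_pi hs),
    ← lintegral_indicator (MeasurableSet.univ_pi hs)]
  have hprod : (Set.univ.pi s).indicator (fun x => ∏ i, f i (x i)) =
      fun x => ∏ i, (s i).indicator (f i) (x i) := by
    funext x
    by_cases hx : x ∈ Set.univ.pi s
    · rw [Set.indicator_of_mem hx]
      exact Finset.prod_congr rfl fun i _ =>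
        (Set.indicator_of_mem (hx i (Set.mem_univ i)) _).symm
    · rw [Set.indicator_of_notMem hx]
      simp only [Set.mem_univ_pi, not_forall] at hx
      obtain ⟨i, hi⟩ := hx
      exact (Finset.prod_eq_zero (Finset.mem_univ i) (Set.indicator_of_notMem hi _)).symm
  rw [hprod, lintegral_pi_prod fun i => (hf i).indicator (hs i)]
  refine Finset.prod_congr rfl fun i _ => ?_
  rw [lintegral_indicator (hs i), withDensity_apply _ (hs i)]

lemma lintegral_pi_withDensity {f : ∀ i, E i → ENNReal} (hf : ∀ i, Measurable (f i))
    [∀ i, SigmaFinite ((μ i).withDensity (f i))] {H : (∀ i, E i) → ENNReal} (hH : Measurable H) :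
    ∫⁻ x, H x ∂(Measure.pi fun i => (μ i).withDensity (f i)) =
      ∫⁻ x, (∏ i, f i (x i)) * H x ∂(Measure.pi μ) := by
  rw [pi_withDensity hf, lintegral_withDensity_eq_lintegral_mul _ (by fun_prop) hH]
  rfl

lemma lintegral_sq_sum_pi_le {f : ∀ i, E i → ℝ} {C : ℝ} (hf : ∀ i, MemLp (f i) 2 (μ i))
    (h0 : ∀ i, ∫ x, f i x ∂(μ i) = 0) (hC : ∀ i, ∫ x, f i x ^ 2 ∂(μ i) ≤ C) :
    ∫⁻ x, ENNReal.ofReal ((∑ i, f i (x i)) ^ 2) ∂(Measure.pi μ) ≤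
      ENNReal.ofReal (Fintype.card ι * C) := by
  have hcoord : ∀ i, MemLp (fun x : ∀ i, E i => f i (x i)) 2 (Measure.pi μ) := fun i =>
    (hf i).comp_measurePreserving (measurePreserving_eval μ i)
  have hsum : MemLp (∑ i, fun x : ∀ i, E i => f i (x i)) 2 (Measure.pi μ) :=
    memLp_finsetSum' _ fun i _ => hcoord i
  have hmean : ∫ x, (∑ i, fun x : ∀ i, E i => f i (x i)) x ∂(Measure.pi μ) = 0 := by
    simp only [Finset.sum_apply]
    rw [integral_finsetSum _ fun i _ => (hcoord i).integrable (by norm_num)]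
    refine Finset.sum_eq_zero fun i _ => ?_
    rw [integral_comp_eval (hf i).aestronglyMeasurable, h0]
  have hsq : ∀ x : ∀ i, E i,
      (∑ i, f i (x i)) ^ 2 = (∑ i, fun x : ∀ i, E i => f i (x i)) x ^ 2 := fun x => by
    rw [Finset.sum_apply]
  simp only [hsq]
  rw [← ofReal_integral_eq_lintegral_ofReal hsum.integrable_sq (ae_of_all _ fun x => sq_nonneg _)]
  apply ENNReal.ofReal_le_ofReal
  calc ∫ x, (∑ i, fun x : ∀ i, E i => f i (x i)) x ^ 2 ∂(Measure.pi μ)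
      = ∑ i, Var[f i; μ i] := by
        rw [← variance_sum_pi hf,
          variance_of_integral_eq_zero hsum.aestronglyMeasurable.aemeasurable hmean]
    _ ≤ ∑ _i : ι, C := Finset.sum_le_sum fun i _ => by
        rw [variance_of_integral_eq_zero (hf i).aestronglyMeasurable.aemeasurable (h0 i)]
        exact hC i
    _ = Fintype.card ι * C := by simp

lemma lintegral_sq_sum_pi_le_of_bdd {f : ∀ i, E i → ℝ} {C : ℝ} (hf : ∀ i, Measurable (f i))
    (h0 : ∀ i, ∫ x, f i x ∂(μ i) = 0) (hC : ∀ i, ∀ᵐ x ∂(μ i), |f i x| ≤ C) :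
    ∫⁻ x, ENNReal.ofReal ((∑ i, f i (x i)) ^ 2) ∂(Measure.pi μ) ≤
      ENNReal.ofReal (Fintype.card ι * C ^ 2) := by
  have hLp : ∀ i, MemLp (f i) 2 (μ i) := fun i =>
    MemLp.of_bound (hf i).aestronglyMeasurable C (hC i)
  refine lintegral_sq_sum_pi_le hLp h0 fun i => ?_
  calc ∫ x, f i x ^ 2 ∂(μ i) ≤ ∫ _, C ^ 2 ∂(μ i) := by
        refine integral_mono_ae (hLp i).integrable_sq (integrable_const _) ?_
        filter_upwards [hC i] with x hx
        exact sq_le_sq' (abs_le.1 hx).1 (abs_le.1 hx).2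
    _ = C ^ 2 := by simp

end Pi

/-! ### Bayes' rule for the symbols given the observations of the relay -/

instance : IsProbabilityMeasure symbolLaw := by
  constructor
  simp only [symbolLaw, Measure.smul_apply, Measure.add_apply, measure_univ, smul_eq_mul]
  rw [one_add_one_eq_two, ENNReal.inv_mul_cancel two_ne_zero ENNReal.ofNat_ne_top]

lemma integral_symbolLaw (f : ℝ → ℝ) : ∫ s, f s ∂symbolLaw = (f 1 + f (-1)) / 2 := by
  rw [symbolLaw, integral_smul_measure, integral_add_measure (integrable_dirac (by simp))
    (integrable_dirac (by simp)), integral_dirac, integral_dirac, ENNReal.toReal_inv,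
    ENNReal.toReal_ofNat, smul_eq_mul]
  ring

lemma lintegral_symbolLaw (f : ℝ → ENNReal) :
    ∫⁻ s, f s ∂symbolLaw = 2⁻¹ * (f 1 + f (-1)) := by
  simp [symbolLaw, lintegral_smul_measure, lintegral_add_measure, mul_add]

lemma ae_symbolLaw_sq_eq_one : ∀ᵐ s ∂symbolLaw, s ^ 2 = 1 := by
  rw [symbolLaw]
  refine Measure.ae_smul_measure ?_ _
  rw [ae_add_measure_iff, ae_dirac_eq, ae_dirac_eq]
  exact ⟨one_pow 2, by norm_num⟩

lemma ae_pi_symbolLaw_sq_eq_one (n : ℕ) :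
    ∀ᵐ s ∂(Measure.pi fun _ : Fin n => symbolLaw), ∀ l, s l ^ 2 = 1 :=
  ae_all_iff.2 fun l => (measurePreserving_eval (fun _ : Fin n => symbolLaw)
    l).quasiMeasurePreserving.ae ae_symbolLaw_sq_eq_one

/-- Density of `N(m, 1)` with respect to the standard normal law. -/
def gaussianTilt (m u : ℝ) : ENNReal := ENNReal.ofReal (Real.exp (m * u - m ^ 2 / 2))

@[fun_prop]
lemma measurable_gaussianTilt (m : ℝ) : Measurable (gaussianTilt m) := by
  unfold gaussianTilt
  fun_prop

lemma withDensity_gaussianTilt (m : ℝ) :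
    (gaussianReal 0 1).withDensity (gaussianTilt m) = gaussianReal m 1 := by
  rw [gaussianReal_of_var_ne_zero _ one_ne_zero, gaussianReal_of_var_ne_zero _ one_ne_zero,
    ← withDensity_mul _ (measurable_gaussianPDF 0 1) (measurable_gaussianTilt m)]
  congr 1
  funext u
  simp only [gaussianPDF, Pi.mul_apply, gaussianTilt]
  rw [← ENNReal.ofReal_mul (gaussianPDFReal_nonneg _ _ _), gaussianPDFReal, gaussianPDFReal,
    mul_assoc _ (Real.exp _), ← Real.exp_add]
  congr 3
  push_cast
  ring

instance (m : ℝ) : IsProbabilityMeasure ((gaussianReal 0 1).withDensity (gaussianTilt m)) := by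
  rw [withDensity_gaussianTilt]
  infer_instance

/-- Density of the relay's observation `U` with respect to the standard normal law. -/
def obsWeight (h₁ u : ℝ) : ENNReal := ENNReal.ofReal (Real.exp (-h₁ ^ 2 / 2) * Real.cosh (h₁ * u))

@[fun_prop]
lemma measurable_obsWeight (h₁ : ℝ) : Measurable (obsWeight h₁) := by
  unfold obsWeight
  fun_prop

/-- Law of the relay's observation `U`. -/
def obsLaw (h₁ : ℝ) : Measure ℝ := (gaussianReal 0 1).withDensity (obsWeight h₁)

lemma lintegral_gaussianTilt (h₁ u : ℝ) :
    ∫⁻ s, gaussianTilt (h₁ * s) u ∂symbolLaw = obsWeight h₁ u := by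
  have htwo : (2⁻¹ : ENNReal) = ENNReal.ofReal 2⁻¹ := by
    rw [ENNReal.ofReal_inv_of_pos two_pos, ENNReal.ofReal_ofNat]
  rw [lintegral_symbolLaw, gaussianTilt, gaussianTilt, obsWeight, htwo,
    ← ENNReal.ofReal_add (by positivity) (by positivity), ← ENNReal.ofReal_mul (by positivity),
    Real.cosh_eq]
  congr 1
  simp only [sub_eq_add_neg, Real.exp_add]
  ring_nf

instance (h₁ : ℝ) : IsProbabilityMeasure (obsLaw h₁) := by
  constructor
  have htilt : ∀ s, ∫⁻ u, gaussianTilt (h₁ * s) u ∂(gaussianReal 0 1) = 1 := fun s => by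
    rw [← setLIntegral_univ, ← withDensity_apply _ MeasurableSet.univ, measure_univ]
  rw [obsLaw, withDensity_apply _ MeasurableSet.univ, setLIntegral_univ]
  simp only [← lintegral_gaussianTilt]
  rw [lintegral_lintegral_swap (by unfold gaussianTilt; fun_prop)]
  simp only [htilt, lintegral_const, measure_univ, mul_one]

lemma obsLaw_absolutelyContinuous (h₁ : ℝ) : obsLaw h₁ ≪ volume :=
  (withDensity_absolutelyContinuous _ _).trans (gaussianReal_absolutelyContinuous 0 one_ne_zero)

lemma absolutelyContinuous_obsLaw (h₁ : ℝ) : volume ≪ obsLaw h₁ := by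
  refine (gaussianReal_absolutelyContinuous' 0 one_ne_zero).trans ?_
  refine withDensity_absolutelyContinuous' (measurable_obsWeight h₁).aemeasurable
    (ae_of_all _ fun u => ?_)
  have := Real.cosh_pos (h₁ * u)
  rw [obsWeight, ne_eq, ENNReal.ofReal_eq_zero, not_le]
  positivity

/-- Density of the symbol `S` given `U = u`, with respect to `symbolLaw`. -/
def postDensity (h₁ u s : ℝ) : ENNReal :=
  ENNReal.ofReal (Real.exp (h₁ * s * u) / Real.cosh (h₁ * u))

@[fun_prop]
lemma measurable_postDensity (h₁ u : ℝ) : Measurable (postDensity h₁ u) := by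
  unfold postDensity
  fun_prop

/-- Conditional law of the symbol `S` given `U = u`. -/
def posterior (h₁ u : ℝ) : Measure ℝ := symbolLaw.withDensity (postDensity h₁ u)

lemma obsWeight_mul_postDensity (h₁ u : ℝ) {s : ℝ} (hs : s ^ 2 = 1) :
    obsWeight h₁ u * postDensity h₁ u s = gaussianTilt (h₁ * s) u := by
  have := Real.cosh_pos (h₁ * u)
  rw [obsWeight, postDensity, gaussianTilt, ← ENNReal.ofReal_mul (by positivity), mul_pow, hs,
    sub_eq_add_neg, Real.exp_add]
  congr 1
  field_simp

instance (h₁ u : ℝ) : IsProbabilityMeasure (posterior h₁ u) := by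
  constructor
  have hc := Real.cosh_pos (h₁ * u)
  rw [posterior, withDensity_apply _ MeasurableSet.univ, setLIntegral_univ,
    lintegral_symbolLaw, postDensity, postDensity, ← ENNReal.ofReal_add (by positivity)
    (by positivity), ← add_div]
  have htwo : (Real.exp (h₁ * 1 * u) + Real.exp (h₁ * -1 * u)) / Real.cosh (h₁ * u) = 2 := by
    rw [div_eq_iff hc.ne', Real.cosh_eq]
    ring_nf
  rw [htwo, ENNReal.ofReal_ofNat, ENNReal.inv_mul_cancel two_ne_zero ENNReal.ofNat_ne_top]

lemma ae_posterior_sq_eq_one (h₁ u : ℝ) : ∀ᵐ s ∂(posterior h₁ u), s ^ 2 = 1 :=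
  (withDensity_absolutelyContinuous _ _).ae_le ae_symbolLaw_sq_eq_one

lemma integral_posterior_sub_tanh (h₁ u : ℝ) :
    ∫ s, (s - Real.tanh (h₁ * u)) ∂(posterior h₁ u) = 0 := by
  have hc := Real.cosh_pos (h₁ * u)
  have hdens : ∀ s, (postDensity h₁ u s).toReal = Real.exp (h₁ * s * u) / Real.cosh (h₁ * u) :=
    fun s => ENNReal.toReal_ofReal (by positivity)
  rw [posterior, integral_withDensity_eq_integral_toReal_smul (measurable_postDensity h₁ u)
    (ae_of_all _ fun s => ENNReal.ofReal_lt_top), integral_symbolLaw]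
  simp only [hdens, smul_eq_mul]
  rw [Real.tanh_eq_sinh_div_cosh, Real.sinh_eq, Real.cosh_eq]
  rw [Real.cosh_eq] at hc
  field_simp
  ring_nf

lemma lintegral_pi_gaussianReal_add {n : ℕ} (m : Seq n) {H : Seq n → ENNReal}
    (hH : Measurable H) :
    ∫⁻ z, H (fun l => m l + z l) ∂(Measure.pi fun _ => gaussianReal 0 1) =
      ∫⁻ u, (∏ l, gaussianTilt (m l) (u l)) * H u ∂(Measure.pi fun _ => gaussianReal 0 1) := by
  have hmap : ∀ l, (gaussianReal 0 1).map (fun z => m l + z) =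
      (gaussianReal 0 1).withDensity (gaussianTilt (m l)) := fun l => by
    rw [gaussianReal_map_const_add, zero_add, withDensity_gaussianTilt]
  have (l : Fin n) : IsProbabilityMeasure ((gaussianReal 0 1).map (fun z => m l + z)) := by
    rw [hmap]
    infer_instance
  rw [← lintegral_pi_withDensity (fun l => measurable_gaussianTilt (m l)) hH]
  simp only [← hmap]
  rw [← Measure.pi_map_pi (f := fun l z => m l + z) fun l => by fun_prop,
    lintegral_map hH (by fun_prop)]

lemma lintegral_symbol_relay (h₁ : ℝ) {n : ℕ} {H : Seq n → Seq n → ENNReal}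
    (hH : Measurable (Function.uncurry H)) :
    ∫⁻ s, ∫⁻ z, H s (fun l => h₁ * s l + z l) ∂(Measure.pi fun _ => gaussianReal 0 1)
        ∂(Measure.pi fun _ => symbolLaw) =
      ∫⁻ u, ∫⁻ s, H s u ∂(Measure.pi fun l => posterior h₁ (u l))
        ∂(Measure.pi fun _ => obsLaw h₁) := by
  have hs : ∀ u : Seq n, Measurable fun s => H s u := fun u => hH.of_uncurry_right
  have (u : ℝ) : IsProbabilityMeasure (symbolLaw.withDensity (postDensity h₁ u)) :=
    inferInstanceAs (IsProbabilityMeasure (posterior h₁ u))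
  have : IsProbabilityMeasure ((gaussianReal 0 1).withDensity (obsWeight h₁)) :=
    inferInstanceAs (IsProbabilityMeasure (obsLaw h₁))
  have hpost : ∀ u : Seq n, ∫⁻ s, H s u ∂(Measure.pi fun l => posterior h₁ (u l)) =
      ∫⁻ s, (∏ l, postDensity h₁ (u l) (s l)) * H s u ∂(Measure.pi fun _ => symbolLaw) := fun u =>
    lintegral_pi_withDensity (fun l => measurable_postDensity h₁ (u l)) (hs u)
  have hjoint : Measurable fun p : Seq n × Seq n =>
      (∏ l, postDensity h₁ (p.1 l) (p.2 l)) * H p.2 p.1 := by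
    have := hH.comp measurable_swap
    unfold postDensity
    fun_prop
  have htilt : Measurable fun p : Seq n × Seq n =>
      (∏ l, gaussianTilt (h₁ * p.1 l) (p.2 l)) * H p.1 p.2 := by
    unfold gaussianTilt
    fun_prop
  simp only [hpost, fun s => lintegral_pi_gaussianReal_add (fun l => h₁ * s l)
    (H := H s) hH.of_uncurry_left]
  rw [obsLaw, lintegral_pi_withDensity (fun _ => measurable_obsWeight h₁)
    hjoint.lintegral_prod_right', lintegral_lintegral_swap htilt.aemeasurable]
  refine lintegral_congr fun u => ?_
  refine Eq.trans ?_ (lintegral_const_mul _ (hjoint.comp measurable_prodMk_left))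
  refine lintegral_congr_ae ?_
  filter_upwards [ae_pi_symbolLaw_sq_eq_one n] with s hs
  rw [← mul_assoc, ← Finset.prod_mul_distrib]
  congr 1
  exact Finset.prod_congr rfl fun l _ => (obsWeight_mul_postDensity h₁ (u l) (hs l)).symm

/-! ### Integration over the network -/

instance (n : ℕ) : IsProbabilityMeasure (primitiveLaw n) := by
  unfold primitiveLaw
  infer_instance

instance (h₁ : ℝ) {n : ℕ} (K : Kernel (Seq n) (Seq n)) [IsMarkovKernel K] :
    IsProbabilityMeasure (networkLaw h₁ K) := by
  unfold networkLaw
  infer_instance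

@[fun_prop]
lemma measurable_seqU (h₁ : ℝ) (n : ℕ) : Measurable (seqU h₁ : Primitive n × Seq n → Seq n) :=
  (measurable_relayInput h₁ n).comp measurable_fst

@[fun_prop]
lemma measurable_seqV (n : ℕ) : Measurable (seqV : Primitive n × Seq n → Seq n) :=
  measurable_snd

@[fun_prop]
lemma measurable_seqX (h₃ : ℝ) (n : ℕ) : Measurable (seqX h₃ : Primitive n × Seq n → Seq n) := by
  unfold seqX
  fun_prop

@[fun_prop]
lemma measurable_seqY (h₂ : ℝ) (n : ℕ) : Measurable (seqY h₂ : Primitive n × Seq n → Seq n) := by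
  unfold seqY
  fun_prop

section Network

variable (h₁ : ℝ) {n : ℕ} (K : Kernel (Seq n) (Seq n)) [IsMarkovKernel K]

lemma lintegral_networkLaw {F : Primitive n × Seq n → ENNReal} (hF : Measurable F) :
    ∫⁻ ω, F ω ∂(networkLaw h₁ K) =
      ∫⁻ s, ∫⁻ z, ∫⁻ v, ∫⁻ a, ∫⁻ b, F ((s, z, a, b), v)
        ∂(Measure.pi fun _ => gaussianReal 0 1) ∂(Measure.pi fun _ => gaussianReal 0 1)
        ∂(K fun l => h₁ * s l + z l)
        ∂(Measure.pi fun _ => gaussianReal 0 1) ∂(Measure.pi fun _ => symbolLaw) := by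
  have hV : Measurable fun w : Primitive n =>
      ∫⁻ v, F (w, v) ∂(K.comap (relayInput h₁) (measurable_relayInput h₁ n) w) :=
    hF.lintegral_kernel_prod_right'
  rw [networkLaw, Measure.lintegral_compProd hF, primitiveLaw, lintegral_prod _ hV.aemeasurable]
  refine lintegral_congr fun s => ?_
  refine (lintegral_prod _ (hV.comp measurable_prodMk_left).aemeasurable).trans ?_
  refine lintegral_congr fun z => ?_
  have hpair : Measurable fun p : (Seq n × Seq n) × Seq n => F ((s, z, p.1.1, p.1.2), p.2) := by
    fun_prop
  refine (lintegral_lintegral_swap (ν := K fun l => h₁ * s l + z l)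
    (f := fun (p : Seq n × Seq n) v => F ((s, z, p), v)) hpair.aemeasurable).trans ?_
  exact lintegral_congr fun v => lintegral_prod _ (by fun_prop)

lemma lintegral_seqU {H : Seq n → ENNReal} (hH : Measurable H) :
    ∫⁻ ω, H (seqU h₁ ω) ∂(networkLaw h₁ K) =
      ∫⁻ u, H u ∂(Measure.pi fun _ => obsLaw h₁) := by
  have hbayes := lintegral_symbol_relay h₁ (H := fun (_ : Seq n) u => H u) (hH.comp measurable_snd)
  rw [lintegral_networkLaw h₁ K (by fun_prop)]
  simpa +unfoldPartialApp only [seqU, relayInput, lintegral_const, measure_univ, mul_one]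
    using hbayes

end Network

/-! ### Weak laws of large numbers -/

/-- Convergence to `0` in probability of random variables `W n`, each on its own space; Mathlib's
`TendstoInMeasure` requires a common space. -/
def VanishesInProb {Ω : ℕ → Type*} [∀ n, MeasurableSpace (Ω n)] (μ : ∀ n, Measure (Ω n))
    (W : ∀ n, Ω n → ℝ) : Prop :=
  ∀ r > 0, Tendsto (fun n => μ n {ω | r ≤ |W n ω|}) atTop (𝓝 0)

namespace VanishesInProb

variable {Ω : ℕ → Type*} [∀ n, MeasurableSpace (Ω n)] {μ : ∀ n, Measure (Ω n)}
  {W W' : ∀ n, Ω n → ℝ}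

lemma add (hW : VanishesInProb μ W) (hW' : VanishesInProb μ W') :
    VanishesInProb μ fun n ω => W n ω + W' n ω := by
  intro r hr
  have hsum := (hW (r / 2) (half_pos hr)).add (hW' (r / 2) (half_pos hr))
  rw [add_zero] at hsum
  refine tendsto_of_tendsto_of_tendsto_of_le_of_le tendsto_const_nhds hsum (fun n => zero_le)
    fun n => (measure_mono fun ω hω => ?_).trans (measure_union_le _ _)
  by_contra hcon
  simp only [Set.mem_union, Set.mem_ofPred_eq, not_or, not_le] at hω hcon
  linarith [abs_add_le (W n ω) (W' n ω)]

lemma const_mul (hW : VanishesInProb μ W) (a : ℝ) :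
    VanishesInProb μ fun n ω => a * W n ω := by
  intro r hr
  have ha : 0 < |a| + 1 := by positivity
  refine tendsto_of_tendsto_of_tendsto_of_le_of_le tendsto_const_nhds
    (hW (r / (|a| + 1)) (by positivity)) (fun n => zero_le) fun n => measure_mono fun ω hω => ?_
  simp only [Set.mem_ofPred_eq, abs_mul] at hω ⊢
  rw [div_le_iff₀ ha]
  nlinarith [abs_nonneg (W n ω)]

lemma congr' (hW : VanishesInProb μ W) (h : ∀ᶠ n in atTop, W n = W' n) : VanishesInProb μ W' :=
  fun r hr => (hW r hr).congr' (h.mono fun _ hn => by simp only [hn])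

lemma of_second_moment (hW : ∀ n, Measurable (W n)) {C : ℝ}
    (hC : ∀ n, ∫⁻ ω, ENNReal.ofReal (W n ω ^ 2) ∂(μ n) ≤ ENNReal.ofReal (n * C)) :
    VanishesInProb μ fun n ω => W n ω / n := by
  intro r hr
  have hlim : Tendsto (fun n : ℕ => ENNReal.ofReal (C / r ^ 2 / n)) atTop (𝓝 0) := by
    rw [← ENNReal.ofReal_zero]
    exact ENNReal.tendsto_ofReal (tendsto_const_div_atTop_nhds_zero_nat _)
  refine tendsto_of_tendsto_of_tendsto_of_le_of_le' tendsto_const_nhds hlim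
    (Eventually.of_forall fun n => zero_le) ?_
  filter_upwards [eventually_gt_atTop 0] with n hn
  have hn' : (0 : ℝ) < n := Nat.cast_pos.2 hn
  have hpos : 0 < (r * n) ^ 2 := by positivity
  calc μ n {ω | r ≤ |W n ω / n|}
      ≤ μ n {ω | ENNReal.ofReal ((r * n) ^ 2) ≤ ENNReal.ofReal (W n ω ^ 2)} := by
        refine measure_mono fun ω hω => ENNReal.ofReal_le_ofReal ?_
        rw [Set.mem_ofPred_eq, abs_div, abs_of_pos hn', le_div_iff₀ hn'] at hω
        rw [← sq_abs (W n ω)]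
        exact pow_le_pow_left₀ (by positivity) hω 2
    _ ≤ (∫⁻ ω, ENNReal.ofReal (W n ω ^ 2) ∂(μ n)) / ENNReal.ofReal ((r * n) ^ 2) :=
        meas_ge_le_lintegral_div (by fun_prop) (ENNReal.ofReal_pos.2 hpos).ne'
          ENNReal.ofReal_ne_top
    _ ≤ ENNReal.ofReal (n * C) / ENNReal.ofReal ((r * n) ^ 2) := by gcongr; exact hC n
    _ = ENNReal.ofReal (C / r ^ 2 / n) := by
        rw [← ENNReal.ofReal_div_of_pos hpos]
        congr 1
        field_simp

end VanishesInProb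

/-- Mean of `f` at the output of the unit-variance Gaussian channel of gain `h` with input `v`. -/
def channelMean (f : ℝ → ℝ) (h v : ℝ) : ℝ := ∫ z, f (h * v + z) ∂(gaussianReal 0 1)

section ChannelMean

variable {f : ℝ → ℝ} {M : ℝ}

@[fun_prop]
lemma measurable_channelMean (hf : Measurable f) (h : ℝ) : Measurable (channelMean f h) := by
  have hjoint : Measurable fun p : ℝ × ℝ => f (h * p.1 + p.2) := by fun_prop
  exact hjoint.stronglyMeasurable.integral_prod_right'.measurable

lemma abs_channelMean_le (hM : ∀ y, |f y| ≤ M) (h v : ℝ) : |channelMean f h v| ≤ M := by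
  simpa [channelMean] using norm_integral_le_of_norm_le_const (μ := gaussianReal 0 1) (C := M)
    (f := fun z => f (h * v + z)) (ae_of_all _ fun z => hM (h * v + z))

lemma integral_sub_channelMean (hf : Measurable f) (hM : ∀ y, |f y| ≤ M) (h v : ℝ) :
    ∫ z, (f (h * v + z) - channelMean f h v) ∂(gaussianReal 0 1) = 0 := by
  have hint : Integrable (fun z => f (h * v + z)) (gaussianReal 0 1) :=
    Integrable.of_bound (by fun_prop : Measurable _).aestronglyMeasurable M
      (ae_of_all _ fun z => hM (h * v + z))
  rw [integral_sub hint (integrable_const _)]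
  simp [channelMean]

end ChannelMean

section Network

variable (h₁ h₂ : ℝ) {f : ℝ → ℝ} {M : ℝ}

section SecondMoment

variable {n : ℕ} (K : Kernel (Seq n) (Seq n)) [IsMarkovKernel K]

lemma lintegral_sq_sum_noiseY_le {c : ℝ → ℝ} (hc : Measurable c) {C : ℝ}
    (hC : ∀ s, s ^ 2 = 1 → |c s| ≤ C) (hf : Measurable f) (hM : ∀ y, |f y| ≤ M) :
    ∫⁻ ω, ENNReal.ofReal ((∑ l, c (ω.1.1 l) *
        (f (seqY h₂ ω l) - channelMean f h₂ (seqV ω l))) ^ 2) ∂(networkLaw h₁ K) ≤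
      ENNReal.ofReal (n * (C * (2 * M)) ^ 2) := by
  rw [lintegral_networkLaw h₁ K (by fun_prop)]
  refine lintegral_le_const ?_
  filter_upwards [ae_pi_symbolLaw_sq_eq_one n] with s hs
  refine lintegral_le_const (ae_of_all _ fun z => lintegral_le_const (ae_of_all _ fun v =>
    lintegral_le_const (ae_of_all _ fun _ => ?_)))
  have hsum := lintegral_sq_sum_pi_le_of_bdd (ι := Fin n) (μ := fun _ => gaussianReal 0 1)
    (f := fun l b => c (s l) * (f (h₂ * v l + b) - channelMean f h₂ (v l))) (C := C * (2 * M))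
    (fun l => by fun_prop)
    (fun l => by rw [integral_const_mul, integral_sub_channelMean hf hM, mul_zero])
    (fun l => ae_of_all _ fun b => by
      rw [abs_mul]
      refine mul_le_mul (hC _ (hs l)) ?_ (abs_nonneg _) ((abs_nonneg _).trans (hC _ (hs l)))
      linarith [abs_sub (f (h₂ * v l + b)) (channelMean f h₂ (v l)), hM (h₂ * v l + b),
        abs_channelMean_le hM h₂ (v l)])
  rw [Fintype.card_fin] at hsum
  exact hsum

lemma lintegral_sq_sum_noiseX_le (hf : Measurable f) (hM : ∀ y, |f y| ≤ M) :
    ∫⁻ ω, ENNReal.ofReal ((∑ l, ω.1.2.2.1 l * f (seqY h₂ ω l)) ^ 2) ∂(networkLaw h₁ K) ≤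
      ENNReal.ofReal (n * M ^ 2) := by
  have hvar : ∫ x : ℝ, x ^ 2 ∂(gaussianReal 0 1) = 1 := by
    have := variance_of_integral_eq_zero (X := fun x : ℝ => x) (μ := gaussianReal 0 1)
      measurable_id.aemeasurable integral_id_gaussianReal
    simpa [variance_fun_id_gaussianReal] using this.symm
  rw [lintegral_networkLaw h₁ K (by fun_prop)]
  refine lintegral_le_const (ae_of_all _ fun s => lintegral_le_const (ae_of_all _ fun z =>
    lintegral_le_const (ae_of_all _ fun v => ?_)))
  simp only [seqY, seqV]
  rw [lintegral_lintegral_swap (by fun_prop)]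
  refine lintegral_le_const (ae_of_all _ fun b => ?_)
  have hsum := lintegral_sq_sum_pi_le (ι := Fin n) (μ := fun _ => gaussianReal 0 1)
    (C := M ^ 2) (f := fun l a => a * f (h₂ * v l + b l))
    (fun l => (memLp_id_gaussianReal 2 : MemLp (fun x : ℝ => x) 2 _).mul_const _)
    (fun l => by rw [integral_mul_const, integral_id_gaussianReal, zero_mul])
    (fun l => by
      simp only [mul_pow]
      rw [integral_mul_const, hvar, one_mul]
      exact sq_le_sq' (abs_le.1 (hM _)).1 (abs_le.1 (hM _)).2)
  simpa only [Fintype.card_fin] using hsum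

lemma lintegral_sq_sum_noiseS_le (hf : Measurable f) (hM : ∀ v, |f v| ≤ M) :
    ∫⁻ ω, ENNReal.ofReal ((∑ l, (ω.1.1 l - Real.tanh (h₁ * seqU h₁ ω l)) *
        f (seqV ω l)) ^ 2) ∂(networkLaw h₁ K) ≤
      ENNReal.ofReal (n * (2 * M) ^ 2) := by
  have hsq : Measurable fun q : (Seq n × Seq n) × Seq n =>
      ENNReal.ofReal ((∑ l, (q.1.1 l - Real.tanh (h₁ * q.1.2 l)) * f (q.2 l)) ^ 2) := by
    fun_prop
  have hV : Measurable (Function.uncurry fun s u : Seq n =>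
      ∫⁻ v, ENNReal.ofReal ((∑ l, (s l - Real.tanh (h₁ * u l)) * f (v l)) ^ 2) ∂(K u)) :=
    hsq.lintegral_kernel_prod_right' (κ := K.comap Prod.snd measurable_snd)
  rw [lintegral_networkLaw h₁ K (by fun_prop)]
  simp only [seqU, relayInput, seqV, lintegral_const, measure_univ, mul_one]
  rw [lintegral_symbol_relay h₁ hV]
  refine lintegral_le_const (ae_of_all _ fun u => ?_)
  rw [lintegral_lintegral_swap (by fun_prop)]
  refine lintegral_le_const (ae_of_all _ fun v => ?_)
  have hsum := lintegral_sq_sum_pi_le_of_bdd (ι := Fin n) (μ := fun l => posterior h₁ (u l))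
    (f := fun l s => (s - Real.tanh (h₁ * u l)) * f (v l)) (C := 2 * M) (fun l => by fun_prop)
    (fun l => by rw [integral_mul_const, integral_posterior_sub_tanh, zero_mul])
    (fun l => by
      filter_upwards [ae_posterior_sq_eq_one h₁ (u l)] with s hs
      rw [abs_mul]
      refine mul_le_mul ?_ (hM _) (abs_nonneg _) zero_le_two
      linarith [abs_sub s (Real.tanh (h₁ * u l)), Real.abs_tanh_lt_one (h₁ * u l),
        sq_le_one_iff_abs_le_one s |>.1 hs.le])
  simpa only [Fintype.card_fin] using hsum

end SecondMoment

variable (K : ∀ n : ℕ, Kernel (Seq n) (Seq n)) [∀ n, IsMarkovKernel (K n)]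

lemma vanishesInProb_mean_seqU_sub_integral (hf : Measurable f) (hM : ∀ u, |f u| ≤ M) :
    VanishesInProb (fun n => networkLaw h₁ (K n))
      fun n ω => (∑ l, f (seqU h₁ ω l)) / n - ∫ u, f u ∂(obsLaw h₁) := by
  set m := ∫ u, f u ∂(obsLaw h₁) with hm
  have hint : Integrable f (obsLaw h₁) :=
    Integrable.of_bound hf.aestronglyMeasurable M (ae_of_all _ hM)
  have hcentred : VanishesInProb (fun n => networkLaw h₁ (K n))
      fun n ω => (∑ l, (f (seqU h₁ ω l) - m)) / n := by
    refine VanishesInProb.of_second_moment (fun n => by fun_prop) (C := (M + |m|) ^ 2) fun n => ?_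
    rw [lintegral_seqU h₁ (K n) (H := fun u => ENNReal.ofReal ((∑ l, (f (u l) - m)) ^ 2))
      (by fun_prop)]
    have hsum := lintegral_sq_sum_pi_le_of_bdd (ι := Fin n) (μ := fun _ => obsLaw h₁)
      (f := fun _ u => f u - m) (C := M + |m|) (fun _ => by fun_prop)
      (fun _ => by rw [integral_sub hint (integrable_const _)]; simp [hm])
      (fun _ => ae_of_all _ fun u => (abs_sub _ _).trans (by linarith [hM u]))
    simpa only [Fintype.card_fin] using hsum
  refine hcentred.congr' ?_
  filter_upwards [eventually_gt_atTop 0] with n hn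
  funext ω
  have hn' : (n : ℝ) ≠ 0 := Nat.cast_ne_zero.2 hn.ne'
  rw [Finset.sum_sub_distrib, Finset.sum_const, Finset.card_univ, Fintype.card_fin, nsmul_eq_mul,
    sub_div, mul_div_cancel_left₀ _ hn']

/- Given everything else, the noises in `Y` and in `X` are independent and centred; given `U` and
`V`, so is `S - tanh (h₁ U)`. Hence the three fluctuations below have second moments of order `n`,
whatever the attack. -/
lemma vanishesInProb_mean_received {h₃ : ℝ} (hh₃ : h₃ ≠ 0) (hf : Measurable f)
    (hM : ∀ y, |f y| ≤ M) (p q : ℝ) :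
    VanishesInProb (fun n => networkLaw h₁ (K n)) fun n ω =>
      (∑ l, (p + q * (seqX h₃ ω l / h₃)) * f (seqY h₂ ω l)) / n -
        (∑ l, (p + q * Real.tanh (h₁ * seqU h₁ ω l)) * channelMean f h₂ (seqV ω l)) / n := by
  have hc : ∀ s : ℝ, s ^ 2 = 1 → |p + q * s| ≤ |p| + |q| := fun s hs => by
    have hs1 := (sq_le_one_iff_abs_le_one s).1 hs.le
    have := abs_add_le p (q * s)
    rw [abs_mul] at this
    nlinarith [abs_nonneg q]
  have hY := VanishesInProb.of_second_moment (μ := fun n => networkLaw h₁ (K n))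
    (fun n => by fun_prop) fun n => lintegral_sq_sum_noiseY_le h₁ h₂ (K n)
      (c := fun s => p + q * s) (by fun_prop) hc hf hM
  have hX := VanishesInProb.of_second_moment (μ := fun n => networkLaw h₁ (K n))
    (fun n => by fun_prop) fun n => lintegral_sq_sum_noiseX_le h₁ h₂ (K n) hf hM
  have hS := VanishesInProb.of_second_moment (μ := fun n => networkLaw h₁ (K n))
    (fun n => by fun_prop) fun n => lintegral_sq_sum_noiseS_le h₁ (K n)
      (measurable_channelMean hf h₂) (abs_channelMean_le hM h₂)
  refine ((hY.add (hX.const_mul (q / h₃))).add (hS.const_mul q)).congr'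
    (Eventually.of_forall fun n => ?_)
  funext ω
  simp only [← mul_div_assoc, ← add_div, ← sub_div, Finset.mul_sum, ← Finset.sum_add_distrib,
    ← Finset.sum_sub_distrib]
  congr 1
  refine Finset.sum_congr rfl fun l _ => ?_
  rw [seqX]
  field_simp
  ring

end Network

/-! ### The decision statistic -/

/-- Test of a received pair: up to the factor `h₁ h₂`, an unbiased estimate of `-regression`. -/
def pairTest (h₁ h₂ h₃ x y : ℝ) : ℝ :=
  (1 - x / h₃) * (Set.Iic (h₁ / h₂)).indicator 1 y -
    (1 + x / h₃) * (Set.Iic (-(h₁ / h₂))).indicator 1 y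

/-- Decision statistic: the deviation of the empirical mean of `pairTest` from its mean under
faithful forwarding, signed and scaled so as to estimate the mean of `gap`. -/
def statistic (h₁ h₂ h₃ : ℝ) (n : ℕ) (x y : Seq n) : ℝ :=
  -(h₁ * h₂) *
    ((∑ l, pairTest h₁ h₂ h₃ (x l) (y l)) / n - ∫ u, regression h₁ h₂ u u ∂(obsLaw h₁))

/-- The mean gap between the input and the output of the relay. -/
def meanGap (h₁ h₂ : ℝ) {n : ℕ} (u v : Seq n) : ℝ := (∑ l, gap h₁ h₂ (u l) (v l)) / n

lemma measurable_statistic (h₁ h₂ h₃ : ℝ) (n : ℕ) :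
    Measurable (Function.uncurry (statistic h₁ h₂ h₃ n)) := by
  have hind : ∀ a : ℝ, Measurable ((Set.Iic a).indicator (1 : ℝ → ℝ)) := fun a =>
    measurable_one.indicator measurableSet_Iic
  unfold statistic pairTest Function.uncurry
  fun_prop

lemma channelMean_indicator_Iic (h₂ y v : ℝ) :
    channelMean ((Set.Iic y).indicator 1) h₂ v = FYV h₂ y v := by
  have hmap : (gaussianReal 0 1).map (fun z => h₂ * v + z) = gaussianReal (h₂ * v) 1 := by
    rw [gaussianReal_map_const_add, zero_add]
  rw [FYV_eq_cdf, cdf_eq_real, ← integral_indicator_one measurableSet_Iic, ← hmap,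
    integral_map (by fun_prop)
      (measurable_one.indicator measurableSet_Iic).aestronglyMeasurable]
  rfl

lemma vanishesInProb_statistic_sub_meanGap (h₁ h₂ : ℝ) {h₃ : ℝ} (hh₃ : h₃ ≠ 0)
    (K : ∀ n : ℕ, Kernel (Seq n) (Seq n)) [∀ n, IsMarkovKernel (K n)] :
    VanishesInProb (fun n => networkLaw h₁ (K n)) fun n ω =>
      statistic h₁ h₂ h₃ n (seqX h₃ ω) (seqY h₂ ω) - meanGap h₁ h₂ (seqU h₁ ω) (seqV ω) := by
  have hmeas : ∀ a : ℝ, Measurable ((Set.Iic a).indicator (1 : ℝ → ℝ)) := fun a =>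
    measurable_one.indicator measurableSet_Iic
  have hbdd : ∀ a y : ℝ, |(Set.Iic a).indicator (1 : ℝ → ℝ) y| ≤ 1 := fun a y => by
    by_cases hy : y ∈ Set.Iic a <;> simp [hy]
  have hplus := vanishesInProb_mean_received h₁ h₂ K hh₃ (hmeas (h₁ / h₂)) (hbdd _) 1 (-1)
  have hminus := vanishesInProb_mean_received h₁ h₂ K hh₃ (hmeas (-(h₁ / h₂))) (hbdd _) 1 1
  have hself := vanishesInProb_mean_seqU_sub_integral h₁ K
    (continuous_regression_self h₁ h₂).measurable fun u => abs_regression_le h₁ h₂ u u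
  refine (((hplus.add (hminus.const_mul (-1))).add hself).const_mul (-(h₁ * h₂))).congr'
    (Eventually.of_forall fun n => ?_)
  funext ω
  simp only [statistic, pairTest, meanGap, gap, regression, channelMean_indicator_Iic,
    ← Finset.mul_sum, Finset.sum_sub_distrib, neg_one_mul, one_mul, ← sub_eq_add_neg]
  ring

/-! ### Quantizer cells -/

section Cells

variable {α β : ℝ} {N : ℕ}

lemma measurableSet_cell (α β : ℝ) (N : ℕ) (j : Fin N) : MeasurableSet (cell α β N j) := by
  unfold cell
  split_ifs
  exacts [measurableSet_Iic, measurableSet_Ioi, measurableSet_Ioc]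

lemma convex_cell (α β : ℝ) (N : ℕ) (j : Fin N) : Convex ℝ (cell α β N j) := by
  unfold cell
  split_ifs
  exacts [convex_Iic _, convex_Ioi _, convex_Ioc _ _]

lemma nonempty_compl_cell (α β : ℝ) (N : ℕ) (j : Fin N) : (cell α β N j)ᶜ.Nonempty := by
  unfold cell
  split_ifs
  exacts [⟨α + 1, by simp⟩, ⟨β, by simp⟩, ⟨_, fun h => lt_irrefl _ h.1⟩]

lemma step_pos (h : α < β) (hN : 3 ≤ N) : 0 < step α β N := by
  have : (3 : ℝ) ≤ N := by exact_mod_cast hN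
  exact div_pos (by linarith) (by linarith)

lemma volume_cell_pos (h : α < β) (hN : 3 ≤ N) (j : Fin N) : 0 < volume (cell α β N j) := by
  have hs := step_pos h hN
  unfold cell
  split_ifs
  · simp
  · simp
  · rw [Real.volume_Ioc, ENNReal.ofReal_pos]
    linarith

lemma exists_mem_cell (h : α < β) (hN : 3 ≤ N) (x : ℝ) : ∃ j, x ∈ cell α β N j := by
  have hs := step_pos h hN
  have hN' : (3 : ℝ) ≤ N := by exact_mod_cast hN
  have hβ : β - α = ((N : ℝ) - 2) * step α β N := by
    rw [step, mul_div_cancel₀ _ (by linarith)]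
  rcases le_or_gt x α with hxα | hαx
  · exact ⟨⟨0, by omega⟩, by simpa [cell] using hxα⟩
  rcases lt_or_ge β x with hβx | hxβ
  · refine ⟨⟨N - 1, by omega⟩, ?_⟩
    simp only [cell]
    rwa [if_neg (by omega), if_pos (by omega)]
  set k := ⌈(x - α) / step α β N⌉₊
  have hpos : 0 < (x - α) / step α β N := div_pos (by linarith) hs
  have hk0 : 0 < k := Nat.ceil_pos.2 hpos
  have hkN : k ≤ N - 2 := by
    apply Nat.ceil_le.2
    rw [Nat.cast_sub (by omega), div_le_iff₀ hs]
    push_cast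
    linarith
  have hle : (x - α) / step α β N ≤ k := Nat.le_ceil _
  have hlt : (k : ℝ) < (x - α) / step α β N + 1 := Nat.ceil_lt_add_one hpos.le
  refine ⟨⟨k, by omega⟩, ?_⟩
  simp only [cell]
  rw [if_neg (by omega), if_neg (by omega), Set.mem_Ioc]
  rw [div_le_iff₀ hs] at hle
  rw [← sub_lt_iff_lt_add, lt_div_iff₀ hs] at hlt
  constructor <;> linarith

lemma abs_sub_le_step_of_mem_cell {j : Fin N} {x y : ℝ} (hx : x ∈ cell α β N j)
    (hy : y ∈ cell α β N j) (hbdd : x ∉ Set.Iic α ∪ Set.Ioi β) : |y - x| ≤ step α β N := by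
  unfold cell at hx hy
  split_ifs at hx hy
  · exact absurd (Or.inl hx) hbdd
  · exact absurd (Or.inr hx) hbdd
  · obtain ⟨x1, x2⟩ := hx
    obtain ⟨y1, y2⟩ := hy
    rw [abs_le]
    constructor <;> linarith

end Cells

namespace QuantScheme

/-- The level `n'` is large enough for both quantizers to be nondegenerate, with cells that nest. -/
structure Regular (Q : QuantScheme) (n' : ℕ) : Prop where
  three_le : 3 ≤ n'
  three_le_nv : 3 ≤ Q.nv n'
  lt₁ : Q.α₁ n' < Q.β₁ n'
  lt₂ : Q.α₂ n' < Q.β₂ n'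
  nested : ∀ (i : Fin n') (j : Fin (Q.nv n')),
    Q.cellU n' i ⊆ Q.cellV n' j ∨ Disjoint (Q.cellU n' i) (Q.cellV n' j)

lemma eventually_regular (Q : QuantScheme) : ∀ᶠ n' in atTop, Q.Regular n' := by
  filter_upwards [eventually_ge_atTop 3, Q.tendsto_nv.eventually_ge_atTop 3, Q.lt₁, Q.lt₂,
    Q.nested] with n' hn' hnv hlt₁ hlt₂ hnested
  exact ⟨hn', hnv, hlt₁, hlt₂, hnested⟩

/-- The union of the two unbounded output cells, outside of which output cells are short. -/
def tail (Q : QuantScheme) (n' : ℕ) : Set ℝ := Set.Iic (Q.α₂ n') ∪ Set.Ioi (Q.β₂ n')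

lemma measurableSet_tail (Q : QuantScheme) (n' : ℕ) : MeasurableSet (Q.tail n') :=
  measurableSet_Iic.union measurableSet_Ioi

lemma tendsto_measureReal_tail (Q : QuantScheme) (μ : Measure ℝ) [IsProbabilityMeasure μ] :
    Tendsto (fun n' => μ.real (Q.tail n')) atTop (𝓝 0) := by
  have hlim : Tendsto (fun n' => cdf μ (Q.α₂ n') + (1 - cdf μ (Q.β₂ n'))) atTop (𝓝 0) := by
    simpa using ((tendsto_cdf_atBot μ).comp Q.tendsto_α₂).add
      (((tendsto_cdf_atTop μ).comp Q.tendsto_β₂).const_sub 1)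
  refine squeeze_zero (fun _ => measureReal_nonneg) (fun n' => ?_) hlim
  refine (measureReal_union_le _ _).trans_eq ?_
  rw [cdf_eq_real, cdf_eq_real, ← Set.compl_Iic, probReal_compl_eq_one_sub measurableSet_Iic]

lemma measurableSet_cellU (Q : QuantScheme) (n' : ℕ) (i : Fin n') :
    MeasurableSet (Q.cellU n' i) := measurableSet_cell _ _ _ _

lemma measurableSet_cellV (Q : QuantScheme) (n' : ℕ) (j : Fin (Q.nv n')) :
    MeasurableSet (Q.cellV n' j) := measurableSet_cell _ _ _ _

variable {Q : QuantScheme} {n' : ℕ}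

lemma Regular.exists_cellU_subset (hQ : Q.Regular n') (i : Fin n') :
    ∃ j, Q.cellU n' i ⊆ Q.cellV n' j := by
  obtain ⟨x, hx⟩ : (Q.cellU n' i).Nonempty :=
    nonempty_of_measure_ne_zero (volume_cell_pos hQ.lt₁ hQ.three_le i).ne'
  obtain ⟨j, hj⟩ := exists_mem_cell hQ.lt₂ hQ.three_le_nv x
  exact ⟨j, (hQ.nested i j).resolve_right fun hd => Set.disjoint_left.1 hd hx hj⟩

lemma Regular.obsLaw_cellU_pos (hQ : Q.Regular n') (h₁ : ℝ) (i : Fin n') :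
    0 < (obsLaw h₁).real (Q.cellU n' i) := by
  rw [measureReal_def, ENNReal.toReal_pos_iff]
  refine ⟨pos_iff_ne_zero.2 fun h => ?_, measure_lt_top _ _⟩
  exact (volume_cell_pos hQ.lt₁ hQ.three_le i).ne' (absolutelyContinuous_obsLaw h₁ h)

lemma Regular.nv_mul_pos (hQ : Q.Regular n') : (0 : ℝ) < Q.nv n' * n' := by
  have h := hQ.three_le
  have hv := hQ.three_le_nv
  positivity

end QuantScheme

/-! ### Empirical kernels -/

section EmpiricalKernel

variable {n : ℕ}

lemma indicator_one_nonneg (B : Set ℝ) (x : ℝ) : 0 ≤ B.indicator (fun _ => (1 : ℝ)) x :=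
  Set.indicator_nonneg (fun _ _ => zero_le_one) x

lemma indicator_one_le_one (B : Set ℝ) (x : ℝ) : B.indicator (fun _ => (1 : ℝ)) x ≤ 1 :=
  Set.indicator_le_self' (fun _ _ => zero_le_one) x

lemma abs_indicator_one_le_one (B : Set ℝ) (x : ℝ) : |B.indicator (fun _ => (1 : ℝ)) x| ≤ 1 := by
  rw [abs_of_nonneg (indicator_one_nonneg B x)]
  exact indicator_one_le_one B x

/-- Number of positions at which the input is in `A` and the output in `B`, for counting the
transitions of a pair of sequences. -/
def jointCount (A B : Set ℝ) (u v : Seq n) : ℝ :=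
  ∑ l, A.indicator (fun _ => (1 : ℝ)) (u l) * B.indicator (fun _ => (1 : ℝ)) (v l)

lemma count_nonneg (B : Set ℝ) (u : Seq n) : 0 ≤ count B u :=
  Finset.sum_nonneg fun _ _ => indicator_one_nonneg _ _

lemma count_le (B : Set ℝ) (u : Seq n) : count B u ≤ n :=
  (Finset.sum_le_sum fun l _ => indicator_one_le_one B (u l)).trans (by simp)

lemma jointCount_nonneg (A B : Set ℝ) (u v : Seq n) : 0 ≤ jointCount A B u v :=
  Finset.sum_nonneg fun _ _ => mul_nonneg (indicator_one_nonneg _ _) (indicator_one_nonneg _ _)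

lemma jointCount_le_count (A B : Set ℝ) (u v : Seq n) : jointCount A B u v ≤ count A u :=
  Finset.sum_le_sum fun _ _ =>
    mul_le_of_le_one_right (indicator_one_nonneg _ _) (indicator_one_le_one _ _)

lemma jointCount_mono_right (A : Set ℝ) {B B' : Set ℝ} (h : B ⊆ B') (u v : Seq n) :
    jointCount A B u v ≤ jointCount A B' u v :=
  Finset.sum_le_sum fun _ _ => mul_le_mul_of_nonneg_left
    (Set.indicator_le_indicator_of_subset h (fun _ => zero_le_one) _) (indicator_one_nonneg _ _)

lemma jointCount_add_jointCount_compl (A B : Set ℝ) (u v : Seq n) :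
    jointCount A B u v + jointCount A Bᶜ u v = count A u := by
  rw [jointCount, jointCount, ← Finset.sum_add_distrib]
  refine Finset.sum_congr rfl fun l _ => ?_
  rw [← mul_add, Set.indicator_self_add_compl_apply, mul_one]

lemma measurable_count {B : Set ℝ} (hB : MeasurableSet B) : Measurable (count B : Seq n → ℝ) :=
  Finset.measurable_fun_sum _ fun l _ =>
    (measurable_const.indicator hB).comp (measurable_pi_apply l)

lemma measurable_deviation (Q : QuantScheme) (n' : ℕ) :
    Measurable fun p : Seq n × Seq n => deviation Q n' p.1 p.2 := by
  refine Finset.measurable_fun_sum _ fun j _ => Finset.measurable_fun_sum _ fun i _ => ?_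
  refine Measurable.abs (Measurable.sub_const ?_ _)
  have hcount : Measurable fun p : Seq n × Seq n => count (Q.cellU n' i) p.1 :=
    (measurable_count (Q.measurableSet_cellU n' i)).comp measurable_fst
  refine Measurable.ite (hcount (measurableSet_singleton 0)) measurable_const
    (Measurable.div ?_ hcount)
  refine Finset.measurable_fun_sum _ fun l _ => Measurable.mul ?_ ?_
  · exact (measurable_const.indicator (Q.measurableSet_cellV n' j)).comp
      ((measurable_pi_apply l).comp measurable_snd)
  · exact (measurable_const.indicator (Q.measurableSet_cellU n' i)).comp
      ((measurable_pi_apply l).comp measurable_fst)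

lemma measurable_R (Q : QuantScheme) (h₁ : ℝ) (n' n : ℕ) :
    Measurable (R Q h₁ n' : Primitive n × Seq n → ℝ) :=
  (measurable_deviation Q n').comp (f := fun ω => (seqU h₁ ω, seqV ω)) (by fun_prop)

variable {Q : QuantScheme} {n' : ℕ}

lemma empKernel_mul_count (Q : QuantScheme) (n' : ℕ) (u v : Seq n) (i : Fin n')
    (j : Fin (Q.nv n')) :
    empKernel Q n' u v i j * count (Q.cellU n' i) u =
      jointCount (Q.cellU n' i) (Q.cellV n' j) u v := by
  rw [empKernel]
  split_ifs with hc
  · rw [zero_mul]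
    exact le_antisymm (jointCount_nonneg _ _ _ _) (hc ▸ jointCount_le_count _ _ _ _)
  · rw [div_mul_cancel₀ _ hc]
    exact Finset.sum_congr rfl fun l _ => mul_comm _ _

lemma abs_empKernel_sub_idKernel_mul_count_of_subset (u v : Seq n) {i : Fin n'}
    {j : Fin (Q.nv n')} (h : Q.cellU n' i ⊆ Q.cellV n' j) :
    |empKernel Q n' u v i j - idKernel Q n' i j| * count (Q.cellU n' i) u =
      jointCount (Q.cellU n' i) (Q.cellV n' j)ᶜ u v := by
  rw [idKernel, if_pos h, ← abs_of_nonneg (count_nonneg (Q.cellU n' i) u), ← abs_mul, sub_mul,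
    empKernel_mul_count, one_mul, abs_sub_comm,
    ← jointCount_add_jointCount_compl _ (Q.cellV n' j) u v, add_sub_cancel_left,
    abs_of_nonneg (jointCount_nonneg _ _ _ _)]

lemma abs_empKernel_sub_idKernel_mul_count_le (hQ : Q.Regular n') (u v : Seq n) (i : Fin n')
    (j : Fin (Q.nv n')) :
    |empKernel Q n' u v i j - idKernel Q n' i j| * count (Q.cellU n' i) u ≤
      jointCount (Q.cellU n' i) (Q.cellU n' i)ᶜ u v := by
  by_cases hsub : Q.cellU n' i ⊆ Q.cellV n' j
  · rw [abs_empKernel_sub_idKernel_mul_count_of_subset u v hsub]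
    exact jointCount_mono_right _ (Set.compl_subset_compl.2 hsub) u v
  · have hd := (hQ.nested i j).resolve_left hsub
    rw [idKernel, if_neg hsub, sub_zero, ← abs_of_nonneg (count_nonneg (Q.cellU n' i) u),
      ← abs_mul, empKernel_mul_count, abs_of_nonneg (jointCount_nonneg _ _ _ _)]
    exact jointCount_mono_right _ hd.subset_compl_left u v

lemma exists_le_jointCount_compl (hQ : Q.Regular n') {u v : Seq n} {δ : ℝ}
    (hdev : δ < deviation Q n' u v) :
    ∃ i, δ / (Q.nv n' * n') * count (Q.cellU n' i) u ≤
      jointCount (Q.cellU n' i) (Q.cellU n' i)ᶜ u v := by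
  have hsum : ∑ _j : Fin (Q.nv n'), ∑ _i : Fin n', δ / (Q.nv n' * n') = δ := by
    simp only [Finset.sum_const, Finset.card_univ, Fintype.card_fin, nsmul_eq_mul]
    rw [← mul_assoc, mul_div_cancel₀ _ hQ.nv_mul_pos.ne']
  rw [← hsum, deviation] at hdev
  obtain ⟨j, -, hj⟩ := Finset.exists_lt_of_sum_lt hdev
  obtain ⟨i, -, hi⟩ := Finset.exists_lt_of_sum_lt hj
  exact ⟨i, (mul_le_mul_of_nonneg_right hi.le (count_nonneg _ _)).trans
    (abs_empKernel_sub_idKernel_mul_count_le hQ u v i j)⟩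

lemma sum_jointCount_compl_le (u v : Seq n) {J : Fin n' → Fin (Q.nv n')}
    (hJ : ∀ i, Q.cellU n' i ⊆ Q.cellV n' (J i)) :
    ∑ i, jointCount (Q.cellU n' i) (Q.cellV n' (J i))ᶜ u v ≤ n * deviation Q n' u v := by
  calc ∑ i, jointCount (Q.cellU n' i) (Q.cellV n' (J i))ᶜ u v
      ≤ ∑ i, n * |empKernel Q n' u v i (J i) - idKernel Q n' i (J i)| := by
        refine Finset.sum_le_sum fun i _ => ?_
        rw [← abs_empKernel_sub_idKernel_mul_count_of_subset u v (hJ i), mul_comm]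
        exact mul_le_mul_of_nonneg_right (count_le _ _) (abs_nonneg _)
    _ = n * ∑ i, |empKernel Q n' u v i (J i) - idKernel Q n' i (J i)| := by rw [Finset.mul_sum]
    _ ≤ n * deviation Q n' u v := by
        refine mul_le_mul_of_nonneg_left ?_ (Nat.cast_nonneg n)
        rw [deviation, Finset.sum_comm]
        exact Finset.sum_le_sum fun i _ => Finset.single_le_sum
          (f := fun j => |empKernel Q n' u v i j - idKernel Q n' i j|)
          (fun j _ => abs_nonneg _) (Finset.mem_univ (J i))

end EmpiricalKernel

/-! ### The mean gap and the deviation of the empirical kernel -/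

section MeanGap

variable {h₁ h₂ : ℝ} {Q : QuantScheme} {n' n : ℕ}

lemma gap_le_of_regular (hQ : Q.Regular n') {J : Fin n' → Fin (Q.nv n')}
    (hJ : ∀ i, Q.cellU n' i ⊆ Q.cellV n' (J i)) (x y : ℝ) :
    gap h₁ h₂ x y ≤ 2 * |h₁ * h₂| *
      (∑ i, (Q.cellU n' i).indicator (fun _ => (1 : ℝ)) x *
          (Q.cellV n' (J i))ᶜ.indicator (fun _ => (1 : ℝ)) y +
        |h₂| * step (Q.α₂ n') (Q.β₂ n') (Q.nv n') +
        (Q.tail n').indicator (fun _ => (1 : ℝ)) x) := by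
  have hA : 0 ≤ 2 * |h₁ * h₂| := by positivity
  have hstep : 0 ≤ |h₂| * step (Q.α₂ n') (Q.β₂ n') (Q.nv n') :=
    mul_nonneg (abs_nonneg _) (step_pos hQ.lt₂ hQ.three_le_nv).le
  have hterm : ∀ i, 0 ≤ (Q.cellU n' i).indicator (fun _ => (1 : ℝ)) x *
      (Q.cellV n' (J i))ᶜ.indicator (fun _ => (1 : ℝ)) y := fun i =>
    mul_nonneg (indicator_one_nonneg _ _) (indicator_one_nonneg _ _)
  have hsum := Finset.sum_nonneg fun i (_ : i ∈ Finset.univ) => hterm i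
  have htail := indicator_one_nonneg (Q.tail n') x
  obtain ⟨i, hi⟩ : ∃ i, x ∈ Q.cellU n' i := exists_mem_cell hQ.lt₁ hQ.three_le x
  by_cases hx : x ∈ Q.tail n'
  · refine (gap_le_two_mul h₁ h₂ x y).trans (le_mul_of_one_le_right hA ?_)
    rw [Set.indicator_of_mem hx]
    linarith
  by_cases hy : y ∈ Q.cellV n' (J i)
  · refine (gap_le_mul_abs_sub h₁ h₂ x y).trans (mul_le_mul_of_nonneg_left ?_ hA)
    have hd := mul_le_mul_of_nonneg_left
      (abs_sub_le_step_of_mem_cell (hJ i hi) hy hx) (abs_nonneg h₂)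
    linarith
  · refine (gap_le_two_mul h₁ h₂ x y).trans (le_mul_of_one_le_right hA ?_)
    have hone := Finset.single_le_sum (fun i _ => hterm i) (Finset.mem_univ i)
    rw [Set.indicator_of_mem hi, Set.indicator_of_mem (Set.mem_compl hy), one_mul] at hone
    linarith

lemma meanGap_le (hQ : Q.Regular n') (hn : 0 < n) (u v : Seq n) :
    meanGap h₁ h₂ u v ≤ 2 * |h₁ * h₂| * (deviation Q n' u v +
      |h₂| * step (Q.α₂ n') (Q.β₂ n') (Q.nv n') + count (Q.tail n') u / n) := by
  have hn' : (0 : ℝ) < n := Nat.cast_pos.2 hn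
  choose J hJ using hQ.exists_cellU_subset
  generalize hσ : step (Q.α₂ n') (Q.β₂ n') (Q.nv n') = σ
  rw [meanGap, div_le_iff₀ hn']
  calc ∑ l, gap h₁ h₂ (u l) (v l)
      ≤ 2 * |h₁ * h₂| * (∑ i, jointCount (Q.cellU n' i) (Q.cellV n' (J i))ᶜ u v +
          n * (|h₂| * σ) + count (Q.tail n') u) := by
        refine (Finset.sum_le_sum fun l _ => gap_le_of_regular hQ hJ (u l) (v l)).trans_eq ?_
        simp only [hσ, ← Finset.mul_sum, Finset.sum_add_distrib, Finset.sum_const, Finset.card_univ,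
          Fintype.card_fin, nsmul_eq_mul, jointCount, count]
        rw [Finset.sum_comm, mul_left_comm |h₂|]
    _ ≤ 2 * |h₁ * h₂| * (n * deviation Q n' u v + n * (|h₂| * σ) + count (Q.tail n') u) := by
        gcongr
        exact sum_jointCount_compl_le u v hJ
    _ = 2 * |h₁ * h₂| * (deviation Q n' u v + |h₂| * σ + count (Q.tail n') u / n) * n := by
        field_simp

/-- The least gap at the input `u` over the outputs at least as far from `u` as the complement of
`B`, which bounds from below the gap of any transition from `u` out of `B`. -/
def exitGap (h₁ h₂ : ℝ) (B : Set ℝ) (u : ℝ) : ℝ :=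
  min (gap h₁ h₂ u (u + Metric.infDist u Bᶜ)) (gap h₁ h₂ u (u - Metric.infDist u Bᶜ))

lemma measurable_exitGap (h₁ h₂ : ℝ) (B : Set ℝ) : Measurable (exitGap h₁ h₂ B) := by
  have : Continuous fun u => Metric.infDist u Bᶜ := Metric.continuous_infDist_pt _
  refine (Continuous.min ?_ ?_).measurable
  · exact (continuous_gap h₁ h₂).comp (f := fun u => (u, u + Metric.infDist u Bᶜ)) (by fun_prop)
  · exact (continuous_gap h₁ h₂).comp (f := fun u => (u, u - Metric.infDist u Bᶜ)) (by fun_prop)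

lemma exitGap_le_gap (hh₁ : h₁ ≠ 0) (hh₂ : h₂ ≠ 0) {B : Set ℝ} {u v : ℝ} (hv : v ∉ B) :
    exitGap h₁ h₂ B u ≤ gap h₁ h₂ u v :=
  min_gap_le hh₁ hh₂ Metric.infDist_nonneg (Metric.infDist_le_dist_of_mem hv)

lemma exitGap_pos (hh₁ : h₁ ≠ 0) (hh₂ : h₂ ≠ 0) {B : Set ℝ} (hB : Bᶜ.Nonempty) {u : ℝ}
    (hu : u ∈ interior B) : 0 < exitGap h₁ h₂ B u := by
  have hd : 0 < Metric.infDist u Bᶜ := by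
    rw [← Metric.infDist_pos_iff_notMem_closure hB, closure_compl]
    exact fun h => h hu
  exact lt_min (gap_pos hh₁ hh₂ (by linarith)) (gap_pos hh₁ hh₂ (by linarith))

/-- The inputs in `B` whose exit gap is below `t`: those so close to the boundary of `B` that
leaving `B` from there is hard to notice. -/
def slowExit (h₁ h₂ : ℝ) (B : Set ℝ) (t : ℝ) : Set ℝ := {u | u ∈ B ∧ exitGap h₁ h₂ B u < t}

lemma measurableSet_slowExit (h₁ h₂ : ℝ) {B : Set ℝ} (hB : MeasurableSet B) (t : ℝ) :
    MeasurableSet (slowExit h₁ h₂ B t) :=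
  hB.inter (measurableSet_lt (measurable_exitGap h₁ h₂ B) measurable_const)

lemma iInter_slowExit_subset_frontier (hh₁ : h₁ ≠ 0) (hh₂ : h₂ ≠ 0) {B : Set ℝ}
    (hB : Bᶜ.Nonempty) : ⋂ m : ℕ, slowExit h₁ h₂ B (1 / ((m : ℝ) + 1)) ⊆ frontier B := by
  intro u hu
  rw [Set.mem_iInter] at hu
  refine ⟨subset_closure (hu 0).1, fun hint => ?_⟩
  obtain ⟨m, hm⟩ := exists_nat_one_div_lt (exitGap_pos hh₁ hh₂ hB hint)
  exact lt_asymm hm (hu m).2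

lemma exists_measureReal_slowExit_lt (hh₁ : h₁ ≠ 0) (hh₂ : h₂ ≠ 0) {μ : Measure ℝ}
    [IsFiniteMeasure μ] {B : Set ℝ} (hB : MeasurableSet B) (hne : Bᶜ.Nonempty)
    (hfrontier : μ (frontier B) = 0) {γ : ℝ} (hγ : 0 < γ) :
    ∃ t > 0, μ.real (slowExit h₁ h₂ B t) < γ := by
  have hanti : Antitone fun m : ℕ => slowExit h₁ h₂ B (1 / ((m : ℝ) + 1)) :=
    fun m k hmk u hu => ⟨hu.1, hu.2.trans_le (Nat.one_div_le_one_div hmk)⟩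
  have hlim := tendsto_measure_iInter_atTop (μ := μ)
    (fun m => (measurableSet_slowExit h₁ h₂ hB _).nullMeasurableSet) hanti ⟨0, measure_ne_top _ _⟩
  rw [measure_mono_null (iInter_slowExit_subset_frontier hh₁ hh₂ hne) hfrontier] at hlim
  obtain ⟨m, hm⟩ := (hlim.eventually_lt_const (ENNReal.ofReal_pos.2 hγ)).exists
  exact ⟨1 / ((m : ℝ) + 1), by positivity,
    (ENNReal.lt_ofReal_iff_toReal_lt (measure_ne_top _ _)).1 hm⟩

lemma mul_jointCount_compl_le (hh₁ : h₁ ≠ 0) (hh₂ : h₂ ≠ 0) {t : ℝ} (ht : 0 ≤ t) (B : Set ℝ)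
    (u v : Seq n) :
    t * jointCount B Bᶜ u v ≤
      ∑ l, gap h₁ h₂ (u l) (v l) + t * count (slowExit h₁ h₂ B t) u := by
  rw [jointCount, count, Finset.mul_sum, Finset.mul_sum, ← Finset.sum_add_distrib]
  refine Finset.sum_le_sum fun l _ => ?_
  have hg := gap_nonneg hh₁ hh₂ (u l) (v l)
  have hi := mul_nonneg ht (indicator_one_nonneg (slowExit h₁ h₂ B t) (u l))
  by_cases hu : u l ∈ B
  swap
  · rw [Set.indicator_of_notMem hu]
    linarith
  by_cases hv : v l ∈ B
  · rw [Set.indicator_of_notMem (Set.notMem_compl_iff.2 hv)]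
    linarith
  rw [Set.indicator_of_mem hu, Set.indicator_of_mem (Set.mem_compl hv)]
  rcases lt_or_ge (exitGap h₁ h₂ B (u l)) t with hslow | hfast
  · rw [Set.indicator_of_mem (show u l ∈ slowExit h₁ h₂ B t from ⟨hu, hslow⟩)]
    linarith
  · have := exitGap_le_gap hh₁ hh₂ (u := u l) hv
    linarith

lemma exists_le_meanGap (hh₁ : h₁ ≠ 0) (hh₂ : h₂ ≠ 0) (hQ : Q.Regular n') (hn : 0 < n) {c : ℝ}
    (hc : 0 ≤ c) {u v : Seq n} (hdev : c * (Q.nv n' * n') < deviation Q n' u v)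
    {p t : Fin n' → ℝ} (ht : ∀ i, 0 ≤ t i)
    (hcell : ∀ i, p i / 2 ≤ count (Q.cellU n' i) u / n)
    (hslow : ∀ i, count (slowExit h₁ h₂ (Q.cellU n' i) (t i)) u / n ≤ c * p i / 4) :
    ∃ i, t i * (c * p i / 4) ≤ meanGap h₁ h₂ u v := by
  have hn' : (0 : ℝ) < n := Nat.cast_pos.2 hn
  obtain ⟨i, hi⟩ := exists_le_jointCount_compl hQ hdev
  refine ⟨i, ?_⟩
  rw [mul_div_cancel_right₀ _ hQ.nv_mul_pos.ne'] at hi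
  have hcell := mul_le_mul_of_nonneg_left ((le_div_iff₀ hn').1 (hcell i)) hc
  have hslow := mul_le_mul_of_nonneg_left ((div_le_iff₀ hn').1 (hslow i)) (ht i)
  have hexit := mul_le_mul_of_nonneg_left (hcell.trans hi) (ht i)
  have hgap := mul_jointCount_compl_le hh₁ hh₂ (ht i) (Q.cellU n' i) u v
  rw [meanGap, le_div_iff₀ hn']
  linarith

end MeanGap

/-! ### Conditioning on events of positive lower limit -/

section Cond

variable {ι : Type*} {l : Filter ι} {Ω : ι → Type*} [∀ n, MeasurableSpace (Ω n)]
  (μ : ∀ n, Measure (Ω n)) {A A' T : ∀ n, Set (Ω n)}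

lemma tendsto_cond_zero (hA : ∀ n, MeasurableSet (A n)) (hsub : ∀ n, A' n ⊆ A n)
    (hpos : 0 < liminf (fun n => μ n (A' n)) l)
    (h0 : Tendsto (fun n => μ n (A n ∩ T n)) l (𝓝 0)) :
    Tendsto (fun n => (cond (μ n) (A n)).real (T n)) l (𝓝 0) := by
  obtain ⟨c, hc0, hc⟩ := exists_between hpos
  have hlim : Tendsto (fun n => c⁻¹ * μ n (A n ∩ T n)) l (𝓝 0) := by
    simpa using ENNReal.Tendsto.const_mul h0 (Or.inr (ENNReal.inv_ne_top.2 hc0.ne'))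
  have hcond : Tendsto (fun n => cond (μ n) (A n) (T n)) l (𝓝 0) := by
    refine tendsto_of_tendsto_of_tendsto_of_le_of_le' tendsto_const_nhds hlim
      (Eventually.of_forall fun n => zero_le) ?_
    filter_upwards [eventually_lt_of_lt_liminf hc] with n hn
    rw [cond_apply (hA n)]
    gcongr
    exact hn.le.trans (measure_mono (hsub n))
  rw [← ENNReal.toReal_zero]
  exact (ENNReal.tendsto_toReal ENNReal.zero_ne_top).comp hcond

lemma tendsto_cond_one [∀ n, IsFiniteMeasure (μ n)] (hA : ∀ n, MeasurableSet (A n))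
    (hT : ∀ n, MeasurableSet (T n)) (hpos : 0 < liminf (fun n => μ n (A n)) l)
    (h0 : Tendsto (fun n => μ n (A n ∩ (T n)ᶜ)) l (𝓝 0)) :
    Tendsto (fun n => (cond (μ n) (A n)).real (T n)) l (𝓝 1) := by
  have hz := (tendsto_cond_zero μ hA (fun n => subset_rfl) hpos h0).const_sub 1
  rw [sub_zero] at hz
  refine hz.congr' ?_
  filter_upwards [eventually_lt_of_lt_liminf hpos] with n hn
  have := cond_isProbabilityMeasure (μ := μ n) (s := A n) hn.ne'
  rw [probReal_compl_eq_one_sub (hT n), sub_sub_cancel]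

end Cond

/-! ### Detection -/

section Detection

variable {h₁ h₂ h₃ : ℝ} {Q : QuantScheme} {n' : ℕ}

lemma VanishesInProb.iUnion {Ω : ℕ → Type*} [∀ n, MeasurableSpace (Ω n)] {μ : ∀ n, Measure (Ω n)}
    {ι : Type*} [Finite ι] {W : ι → ∀ n, Ω n → ℝ} (hW : ∀ i, VanishesInProb μ (W i)) {r : ι → ℝ}
    (hr : ∀ i, 0 < r i) :
    Tendsto (fun n => μ n (⋃ i, {ω | r i ≤ |W i n ω|})) atTop (𝓝 0) := by
  have := Fintype.ofFinite ι
  have hs := tendsto_finsetSum Finset.univ fun i (_ : i ∈ Finset.univ) => hW i (r i) (hr i)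
  rw [Finset.sum_const_zero] at hs
  exact tendsto_of_tendsto_of_tendsto_of_le_of_le tendsto_const_nhds hs (fun n => zero_le)
    fun n => measure_iUnion_fintype_le _ _

lemma vanishesInProb_count (h₁ : ℝ) {B : Set ℝ} (hB : MeasurableSet B)
    (K : ∀ n : ℕ, Kernel (Seq n) (Seq n)) [∀ n, IsMarkovKernel (K n)] :
    VanishesInProb (fun n => networkLaw h₁ (K n))
      fun n ω => count B (seqU h₁ ω) / n - (obsLaw h₁).real B := by
  have h := vanishesInProb_mean_seqU_sub_integral h₁ K (measurable_const.indicator hB)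
    (abs_indicator_one_le_one B)
  rwa [show ∫ u, B.indicator (fun _ => (1 : ℝ)) u ∂(obsLaw h₁) = (obsLaw h₁).real B from
    integral_indicator_one hB] at h

lemma exists_measureReal_slowExit_cellU_lt (hh₁ : h₁ ≠ 0) (hh₂ : h₂ ≠ 0) (i : Fin n') {γ : ℝ}
    (hγ : 0 < γ) :
    ∃ t > 0, (obsLaw h₁).real (slowExit h₁ h₂ (Q.cellU n' i) t) < γ :=
  exists_measureReal_slowExit_lt hh₁ hh₂ (Q.measurableSet_cellU n' i)
    (nonempty_compl_cell _ _ _ _)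
    (obsLaw_absolutelyContinuous h₁ ((convex_cell _ _ _ _).addHaar_frontier volume)) hγ

lemma tendsto_missedDetection (hh₁ : h₁ ≠ 0) (hh₂ : h₂ ≠ 0) (hh₃ : h₃ ≠ 0) (hQ : Q.Regular n')
    {c τ : ℝ} (hc : 0 < c) (hτ : 0 < τ) {t : Fin n' → ℝ} (ht : ∀ i, 0 ≤ t i)
    (hslow : ∀ i, (obsLaw h₁).real (slowExit h₁ h₂ (Q.cellU n' i) (t i)) <
      c * (obsLaw h₁).real (Q.cellU n' i) / 8)
    (hτt : ∀ i, 2 * τ < t i * (c * (obsLaw h₁).real (Q.cellU n' i) / 4))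
    (K : ∀ n : ℕ, Kernel (Seq n) (Seq n)) [∀ n, IsMarkovKernel (K n)] :
    Tendsto (fun n => networkLaw h₁ (K n) ({ω | c * (Q.nv n' * n') < R Q h₁ n' ω} ∩
      {ω | τ < statistic h₁ h₂ h₃ n (seqX h₃ ω) (seqY h₂ ω)}ᶜ)) atTop (𝓝 0) := by
  set p : Fin n' → ℝ := fun i => (obsLaw h₁).real (Q.cellU n' i)
  have hp : ∀ i, 0 < p i := hQ.obsLaw_cellU_pos h₁
  set A : Fin n' → Set ℝ := fun i => slowExit h₁ h₂ (Q.cellU n' i) (t i)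
  have hstat := vanishesInProb_statistic_sub_meanGap h₁ h₂ hh₃ K τ hτ
  have hcell := VanishesInProb.iUnion (r := fun i => p i / 2)
    (fun i => vanishesInProb_count h₁ (Q.measurableSet_cellU n' i) K) fun i => half_pos (hp i)
  have hexit := VanishesInProb.iUnion (r := fun i => c * p i / 8)
    (fun i => vanishesInProb_count h₁
      (measurableSet_slowExit h₁ h₂ (Q.measurableSet_cellU n' i) (t i)) K)
    fun i => by have := hp i; positivity
  have hbad := (hstat.add hcell).add hexit
  simp only [add_zero] at hbad
  refine tendsto_of_tendsto_of_tendsto_of_le_of_le' tendsto_const_nhds hbad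
    (Eventually.of_forall fun n => zero_le) ?_
  filter_upwards [eventually_gt_atTop 0] with n hn
  refine le_trans (measure_mono ?_) ((measure_union_le _ _).trans
    (add_le_add_left (measure_union_le _ _) _))
  rintro ω ⟨hR, hD⟩
  simp only [Set.mem_ofPred_eq, Set.mem_compl_iff, not_lt] at hR hD
  by_contra hgood
  simp only [Set.mem_union, Set.mem_iUnion, Set.mem_ofPred_eq] at hgood
  push Not at hgood
  obtain ⟨⟨hstat, hcell⟩, hexit⟩ := hgood
  obtain ⟨i, hi⟩ := exists_le_meanGap hh₁ hh₂ hQ hn hc.le hR (p := p) ht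
    (fun i => by linarith [(abs_lt.1 (hcell i)).1])
    (fun i => by linarith [(abs_lt.1 (hexit i)).2, hslow i])
  linarith [(abs_lt.1 hstat).1, hτt i]

lemma exists_threshold (hh₁ : h₁ ≠ 0) (hh₂ : h₂ ≠ 0) (hh₃ : h₃ ≠ 0) (hQ : Q.Regular n')
    {δ η : ℝ} (hδ : 0 < δ) (hη : 0 < η) :
    ∃ τ, (0 < τ ∧ τ < η) ∧ ∀ K : ∀ n : ℕ, Kernel (Seq n) (Seq n), (∀ n, IsMarkovKernel (K n)) →
      Tendsto (fun n => networkLaw h₁ (K n) ({ω | δ < R Q h₁ n' ω} ∩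
        {ω | τ < statistic h₁ h₂ h₃ n (seqX h₃ ω) (seqY h₂ ω)}ᶜ)) atTop (𝓝 0) := by
  obtain ⟨c, hc, rfl⟩ : ∃ c > 0, c * (Q.nv n' * n') = δ :=
    ⟨δ / (Q.nv n' * n'), div_pos hδ hQ.nv_mul_pos, div_mul_cancel₀ _ hQ.nv_mul_pos.ne'⟩
  have hp := hQ.obsLaw_cellU_pos h₁
  choose t ht0 ht using fun i => exists_measureReal_slowExit_cellU_lt (Q := Q) (n' := n') hh₁ hh₂ i
    (γ := c * (obsLaw h₁).real (Q.cellU n' i) / 8) (by have := hp i; positivity)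
  obtain ⟨τ, hτt, hτη, hτ⟩ : ∃ τ : ℝ,
      (∀ i, τ < t i * (c * (obsLaw h₁).real (Q.cellU n' i) / 4) / 2) ∧ τ < η ∧ 0 < τ := by
    refine Eventually.exists (f := 𝓝[>] (0 : ℝ))
      ((eventually_all.2 fun i => ?_).and (Eventually.and ?_ self_mem_nhdsWithin))
    · exact nhdsWithin_le_nhds (eventually_lt_nhds
        (by have := ht0 i; have := hp i; positivity))
    · exact nhdsWithin_le_nhds (eventually_lt_nhds hη)
  exact ⟨τ, ⟨hτ, hτη⟩, fun K hK => tendsto_missedDetection hh₁ hh₂ hh₃ hQ hc hτ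
    (fun i => (ht0 i).le) ht (fun i => by linarith [hτt i]) K⟩

/-- A level that the statistic exceeds only rarely when the deviation is at most `δ`: the bound
`meanGap_le` with slack `δ` both in the frequency of the tail and in the statistic. -/
def faithfulBound (h₁ h₂ : ℝ) (Q : QuantScheme) (n' : ℕ) (δ : ℝ) : ℝ :=
  2 * |h₁ * h₂| * (δ + |h₂| * step (Q.α₂ n') (Q.β₂ n') (Q.nv n') +
    ((obsLaw h₁).real (Q.tail n') + δ)) + δ

lemma tendsto_faithfulBound (h₁ h₂ : ℝ) (Q : QuantScheme) :
    Tendsto (Function.uncurry (faithfulBound h₁ h₂ Q)) (atTop ×ˢ 𝓝[>] (0 : ℝ)) (𝓝 0) := by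
  have hδ : Tendsto (fun p : ℕ × ℝ => p.2) (atTop ×ˢ 𝓝[>] (0 : ℝ)) (𝓝 0) :=
    (tendsto_id'.2 nhdsWithin_le_nhds).comp tendsto_snd
  have hstep := Q.tendsto_step₂.comp (tendsto_fst (f := atTop) (g := 𝓝[>] (0 : ℝ)))
  have htail := (Q.tendsto_measureReal_tail (obsLaw h₁)).comp
    (tendsto_fst (f := atTop) (g := 𝓝[>] (0 : ℝ)))
  have hlim := (((hδ.add (hstep.const_mul |h₂|)).add (htail.add hδ)).const_mul
    (2 * |h₁ * h₂|)).add hδ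
  simp only [mul_zero, add_zero] at hlim
  exact hlim

lemma tendsto_falseAlarm (hh₃ : h₃ ≠ 0) (hQ : Q.Regular n') {δ : ℝ} (hδ : 0 < δ)
    (K : ∀ n : ℕ, Kernel (Seq n) (Seq n)) [∀ n, IsMarkovKernel (K n)] :
    Tendsto (fun n => networkLaw h₁ (K n) ({ω | R Q h₁ n' ω ≤ δ} ∩
      {ω | faithfulBound h₁ h₂ Q n' δ < statistic h₁ h₂ h₃ n (seqX h₃ ω) (seqY h₂ ω)}))
      atTop (𝓝 0) := by
  have hbad := (vanishesInProb_statistic_sub_meanGap h₁ h₂ hh₃ K δ hδ).add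
    (vanishesInProb_count h₁ (Q.measurableSet_tail n') K δ hδ)
  rw [add_zero] at hbad
  refine tendsto_of_tendsto_of_tendsto_of_le_of_le' tendsto_const_nhds hbad
    (Eventually.of_forall fun n => zero_le) ?_
  filter_upwards [eventually_gt_atTop 0] with n hn
  refine le_trans (measure_mono ?_) (measure_union_le _ _)
  rintro ω ⟨hR, hD⟩
  simp only [Set.mem_ofPred_eq] at hR hD
  by_contra hgood
  simp only [Set.mem_union, Set.mem_ofPred_eq] at hgood
  push Not at hgood
  obtain ⟨hstat, htail⟩ := hgood
  have hgap := (meanGap_le (h₁ := h₁) (h₂ := h₂) hQ hn (seqU h₁ ω) (seqV ω)).trans <|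
    mul_le_mul_of_nonneg_left (add_le_add (add_le_add_left hR _)
      (sub_lt_iff_lt_add'.1 (abs_lt.1 htail).2).le) (by positivity)
  rw [faithfulBound] at hD
  linarith [(abs_lt.1 hstat).2]

end Detection

/-! ### Manipulable channels -/

lemma eq_dirac_of_ae_eq {E : Type*} [MeasurableSpace E] {μ : Measure E} [IsProbabilityMeasure μ]
    {u : E} (h : ∀ᵐ v ∂μ, v = u) : μ = Measure.dirac u := by
  rw [← Measure.map_id (μ := μ), Measure.map_congr (f := id) (g := fun _ => u) h,
    Measure.map_const, measure_univ, one_smul]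

lemma eq_dirac_of_integral_gap_eq_zero {h₁ h₂ : ℝ} (hh₁ : h₁ ≠ 0) (hh₂ : h₂ ≠ 0) {u : ℝ}
    {μ : Measure ℝ} [IsProbabilityMeasure μ] (h : ∫ v, gap h₁ h₂ u v ∂μ = 0) :
    μ = Measure.dirac u := by
  have hmeas : Measurable (gap h₁ h₂ u) :=
    ((continuous_gap h₁ h₂).comp (f := fun v => (u, v)) (by fun_prop)).measurable
  have hint : Integrable (gap h₁ h₂ u) μ :=
    .of_bound hmeas.aestronglyMeasurable (2 * |h₁ * h₂|) (ae_of_all _ fun v => by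
      rw [Real.norm_of_nonneg (gap_nonneg hh₁ hh₂ u v)]
      exact gap_le_two_mul h₁ h₂ u v)
  apply eq_dirac_of_ae_eq
  filter_upwards [(integral_eq_zero_iff_of_nonneg (gap_nonneg hh₁ hh₂ u) hint).1 h] with v hv
  by_contra hvu
  exact (gap_pos hh₁ hh₂ hvu).ne' hv

lemma fUS_eq_mul_exp (h₁ u : ℝ) {s : ℝ} (hs : s ^ 2 = 1) :
    fUS h₁ u s = gaussianPDFReal 0 1 u * Real.exp (-h₁ ^ 2 / 2) * Real.exp (s * (h₁ * u)) := by
  rw [fUS, gaussianPDFReal, gaussianPDFReal, mul_assoc (_ * _), ← Real.exp_add,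
    mul_assoc _ (Real.exp _), ← Real.exp_add]
  congr 2
  push_cast
  linear_combination (-h₁ ^ 2 / 2) * hs

lemma fUS_one_sub_fUS_neg_one (h₁ u : ℝ) :
    fUS h₁ u 1 - fUS h₁ u (-1) = Real.tanh (h₁ * u) * (fUS h₁ u 1 + fUS h₁ u (-1)) := by
  have : 0 < Real.exp (h₁ * u) + Real.exp (-(h₁ * u)) := by positivity
  rw [fUS_eq_mul_exp h₁ u (one_pow 2), fUS_eq_mul_exp h₁ u neg_one_sq, one_mul, neg_one_mul,
    Real.tanh_eq]
  field_simp

lemma integrable_fUS (h₁ s : ℝ) : Integrable fun u => fUS h₁ u s := integrable_gaussianPDFReal _ _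

lemma fUS_pos (h₁ u s : ℝ) : 0 < fUS h₁ u s := gaussianPDFReal_pos _ _ _ one_ne_zero

lemma abs_FYV_le_one (h₂ y v : ℝ) : |FYV h₂ y v| ≤ 1 :=
  (abs_of_nonneg (FYV_nonneg _ _ _)).trans_le (FYV_le_one _ _ _)

lemma integrable_FYV (h₂ y : ℝ) (μ : Measure ℝ) [IsFiniteMeasure μ] : Integrable (FYV h₂ y) μ :=
  .of_bound (measurable_FYV h₂ y).aestronglyMeasurable 1 (ae_of_all _ (abs_FYV_le_one h₂ y))

lemma integrable_mul_FYV (h₂ : ℝ) {f : ℝ → ℝ} (hf : Integrable f) (y : ℝ) :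
    Integrable fun u => f u * FYV h₂ y u :=
  hf.mul_bdd (measurable_FYV h₂ y).aestronglyMeasurable (ae_of_all _ (abs_FYV_le_one h₂ y))

/-- The amount by which replacing the input `u` by an output drawn from `Ψ u` changes the
distribution function of `Y` at `y`. -/
def outputShift (h₂ : ℝ) (Ψ : Kernel ℝ ℝ) (y u : ℝ) : ℝ := (∫ v, FYV h₂ y v ∂(Ψ u)) - FYV h₂ y u

section OutputShift

variable (h₁ h₂ : ℝ) (Ψ : Kernel ℝ ℝ)

lemma measurable_integral_FYV (y : ℝ) : Measurable fun u => ∫ v, FYV h₂ y v ∂(Ψ u) :=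
  (measurable_FYV h₂ y).stronglyMeasurable.integral_kernel.measurable

variable [IsMarkovKernel Ψ]

lemma abs_integral_FYV_le_one (y u : ℝ) : |∫ v, FYV h₂ y v ∂(Ψ u)| ≤ 1 := by
  simpa using norm_integral_le_of_norm_le_const (μ := Ψ u) (f := FYV h₂ y)
    (ae_of_all _ (abs_FYV_le_one h₂ y))

lemma integrable_mul_integral_FYV {f : ℝ → ℝ} (hf : Integrable f) (y : ℝ) :
    Integrable fun u => f u * ∫ v, FYV h₂ y v ∂(Ψ u) :=
  hf.mul_bdd (measurable_integral_FYV h₂ Ψ y).aestronglyMeasurable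
    (ae_of_all _ (abs_integral_FYV_le_one h₂ Ψ y))

lemma integrable_mul_outputShift {f : ℝ → ℝ} (hf : Integrable f) (y : ℝ) :
    Integrable fun u => f u * outputShift h₂ Ψ y u := by
  simp only [outputShift, mul_sub]
  exact (integrable_mul_integral_FYV h₂ Ψ hf y).sub (integrable_mul_FYV h₂ hf y)

lemma integral_fUX_mul_outputShift (h₃ x y : ℝ) :
    ∫ u, fUX h₁ h₃ u x * outputShift h₂ Ψ y u =
      pSX h₃ 1 x * (∫ u, fUS h₁ u 1 * outputShift h₂ Ψ y u) +
        pSX h₃ (-1) x * ∫ u, fUS h₁ u (-1) * outputShift h₂ Ψ y u := by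
  have hint : ∀ s, Integrable fun u => pSX h₃ s x * (fUS h₁ u s * outputShift h₂ Ψ y u) :=
    fun s => (integrable_mul_outputShift h₂ Ψ (integrable_fUS h₁ s) y).const_mul _
  rw [← integral_const_mul, ← integral_const_mul, ← integral_add (hint 1) (hint (-1))]
  exact integral_congr_ae (ae_of_all _ fun u => by simp only [fUX]; ring)

lemma integral_gap (u : ℝ) :
    ∫ v, gap h₁ h₂ u v ∂(Ψ u) =
      -(h₁ * h₂) * ((1 - Real.tanh (h₁ * u)) * outputShift h₂ Ψ (h₁ / h₂) u -
        (1 + Real.tanh (h₁ * u)) * outputShift h₂ Ψ (-(h₁ / h₂)) u) := by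
  have hF := fun y => integrable_FYV h₂ y (Ψ u)
  have hreg : Integrable (regression h₁ h₂ u) (Ψ u) :=
    ((hF _).const_mul _).sub ((hF _).const_mul _)
  simp only [gap]
  rw [integral_const_mul, integral_sub hreg (integrable_const _), integral_const,
    probReal_univ, one_smul]
  simp only [regression]
  rw [integral_sub ((hF _).const_mul _) ((hF _).const_mul _), integral_const_mul,
    integral_const_mul, outputShift, outputShift]
  ring

/- The law of `U` given `S = ±1` weighs the shift at `∓h₁ / h₂` exactly as the posterior mean
`tanh` does in `regression`. -/
lemma fUS_add_mul_integral_gap (u : ℝ) :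
    (fUS h₁ u 1 + fUS h₁ u (-1)) * ∫ v, gap h₁ h₂ u v ∂(Ψ u) =
      2 * (h₁ * h₂) * (fUS h₁ u 1 * outputShift h₂ Ψ (-(h₁ / h₂)) u) -
        2 * (h₁ * h₂) * (fUS h₁ u (-1) * outputShift h₂ Ψ (h₁ / h₂) u) := by
  rw [integral_gap]
  linear_combination (-(h₁ * h₂) * (outputShift h₂ Ψ (h₁ / h₂) u +
    outputShift h₂ Ψ (-(h₁ / h₂)) u)) * fUS_one_sub_fUS_neg_one h₁ u

end OutputShift

lemma eq_zero_of_forall_pSX_mul_add_eq_zero {h₃ : ℝ} (hh₃ : h₃ ≠ 0) {a b : ℝ}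
    (h : ∀ x, pSX h₃ 1 x * a + pSX h₃ (-1) x * b = 0) : a = 0 ∧ b = 0 := by
  have hexp : ∀ x, Real.exp (-(x - h₃ * 1) ^ 2 / 2) * a +
      Real.exp (-(x - h₃ * (-1)) ^ 2 / 2) * b = 0 := fun x => by
    have hx := h x
    rw [pSX, pSX, div_mul_eq_mul_div, div_mul_eq_mul_div, ← add_div, div_eq_zero_iff] at hx
    exact hx.resolve_right (by positivity)
  have hba : b = -a := by
    have h0 := hexp 0
    rw [show (0 - h₃ * (-1)) ^ 2 = (0 - h₃ * 1) ^ 2 by ring, ← mul_add] at h0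
    linarith [(mul_eq_zero.1 h0).resolve_left (Real.exp_pos _).ne']
  have ha : a = 0 := by
    have h1 := hexp 1
    rw [hba, mul_neg, ← sub_eq_add_neg, ← sub_mul] at h1
    refine (mul_eq_zero.1 h1).resolve_left (sub_ne_zero.2 fun he => hh₃ ?_)
    linarith [Real.exp_injective he]
  exact ⟨ha, by rw [hba, ha, neg_zero]⟩

lemma integral_fUS_mul_outputShift_eq_zero {h₁ h₂ h₃ : ℝ} (hh₃ : h₃ ≠ 0) {Ψ : Kernel ℝ ℝ}
    [IsMarkovKernel Ψ] {y : ℝ} (h : ∀ x, ∫ u, fUX h₁ h₃ u x * (∫ v, FYV h₂ y v ∂(Ψ u)) =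
      ∫ u, fUX h₁ h₃ u x * FYV h₂ y u) :
    ∫ u, fUS h₁ u 1 * outputShift h₂ Ψ y u = 0 ∧
      ∫ u, fUS h₁ u (-1) * outputShift h₂ Ψ y u = 0 := by
  refine eq_zero_of_forall_pSX_mul_add_eq_zero hh₃ fun x => ?_
  have hfUX : Integrable fun u => fUX h₁ h₃ u x :=
    ((integrable_fUS h₁ 1).const_mul _).add ((integrable_fUS h₁ (-1)).const_mul _)
  rw [← integral_fUX_mul_outputShift]
  simp only [outputShift, mul_sub]
  rw [integral_sub (integrable_mul_integral_FYV h₂ Ψ hfUX y) (integrable_mul_FYV h₂ hfUX y), h x,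
    sub_self]

lemma nonManipulable_of_ne_zero {h₁ h₂ h₃ : ℝ} (hh₁ : h₁ ≠ 0) (hh₂ : h₂ ≠ 0) (hh₃ : h₃ ≠ 0) :
    NonManipulable h₁ h₂ h₃ := by
  rintro ⟨Ψ, hΨ, hne, heq⟩
  have hzero := fun y => integral_fUS_mul_outputShift_eq_zero hh₃ fun x => heq x y
  have hint := fun s y =>
    (integrable_mul_outputShift h₂ Ψ (integrable_fUS h₁ s) y).const_mul (2 * (h₁ * h₂))
  have hpos : ∀ u, 0 < fUS h₁ u 1 + fUS h₁ u (-1) := fun u =>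
    add_pos (fUS_pos _ _ _) (fUS_pos _ _ _)
  have hmean : ∀ᵐ u, (fUS h₁ u 1 + fUS h₁ u (-1)) * ∫ v, gap h₁ h₂ u v ∂(Ψ u) = 0 := by
    refine (integral_eq_zero_iff_of_nonneg (fun u => mul_nonneg (hpos u).le
      (integral_nonneg (gap_nonneg hh₁ hh₂ u))) ?_).1 ?_ <;> simp only [fUS_add_mul_integral_gap]
    · exact (hint _ _).sub (hint _ _)
    · rw [integral_sub (hint _ _) (hint _ _), integral_const_mul, integral_const_mul,
        (hzero _).1, (hzero _).2, mul_zero, sub_zero]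
  refine hne ?_
  filter_upwards [hmean] with u hu
  exact eq_dirac_of_integral_gap_eq_zero hh₁ hh₂ ((mul_eq_zero.1 hu).resolve_left (hpos u).ne')

lemma fUX_neg {h₁ h₃ : ℝ} (h : h₁ = 0 ∨ h₃ = 0) (u x : ℝ) : fUX h₁ h₃ (-u) x = fUX h₁ h₃ u x := by
  have hneg : ∀ m, gaussianPDFReal m 1 (-u) = gaussianPDFReal (-m) 1 u := fun m => by
    rw [gaussianPDFReal, gaussianPDFReal, ← neg_add', neg_sq, sub_neg_eq_add]
  rcases h with rfl | rfl
  · simp only [fUX, fUS, hneg, zero_mul, neg_zero]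
  · simp only [fUX, fUS, pSX, hneg, mul_one, mul_neg, neg_neg, neg_zero]
    ring

lemma manipulable_of_eq_zero {h₁ h₂ h₃ : ℝ} (h : h₁ = 0 ∨ h₂ = 0 ∨ h₃ = 0) :
    Manipulable h₁ h₂ h₃ := by
  refine ⟨Kernel.deterministic (fun u => -u) measurable_neg, inferInstance, fun hae => ?_,
    fun x y => ?_⟩
  · have hne : ∀ᵐ u : ℝ, u ≠ 0 := by simp [ae_iff]
    obtain ⟨u, hu, hu0⟩ := (hae.and hne).exists
    rw [Kernel.deterministic_apply] at hu
    exact hu0 (self_eq_neg.1 (dirac_eq_dirac_iff.1 hu).symm)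
  · simp only [Kernel.deterministic_apply, integral_dirac]
    rcases or_left_comm.1 h with rfl | h
    · simp only [FYV, zero_mul]
    calc ∫ u, fUX h₁ h₃ u x * FYV h₂ y (-u) = ∫ u, fUX h₁ h₃ (-u) x * FYV h₂ y (-u) := by
          simp_rw [fUX_neg h]
      _ = ∫ u, fUX h₁ h₃ u x * FYV h₂ y u :=
          integral_neg_eq_self (fun u => fUX h₁ h₃ u x * FYV h₂ y u) volume

lemma nonManipulable_iff (h₁ h₂ h₃ : ℝ) :
    NonManipulable h₁ h₂ h₃ ↔ h₁ ≠ 0 ∧ h₂ ≠ 0 ∧ h₃ ≠ 0 := by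
  refine ⟨fun h => ?_, fun ⟨hh₁, hh₂, hh₃⟩ => nonManipulable_of_ne_zero hh₁ hh₂ hh₃⟩
  have := mt manipulable_of_eq_zero h
  tauto

/-! ### Faithful forwarding and sign reversal -/

/-- Faithful forwarding `V = U`, as an attack. -/
def faithful (n : ℕ) : Kernel (Seq n) (Seq n) := Kernel.deterministic (fun u => u) measurable_id

/-- The attack `V = -U`, which the destination cannot tell from faithful forwarding when one of the
coefficients vanishes. -/
def reversal (n : ℕ) : Kernel (Seq n) (Seq n) := Kernel.deterministic (fun u => -u) measurable_neg

instance (n : ℕ) : IsMarkovKernel (faithful n) := by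
  unfold faithful
  infer_instance

instance (n : ℕ) : IsMarkovKernel (reversal n) := by
  unfold reversal
  infer_instance

lemma networkLaw_deterministic (h₁ : ℝ) {n : ℕ} {g : Seq n → Seq n} (hg : Measurable g) :
    networkLaw h₁ (Kernel.deterministic g hg) =
      (primitiveLaw n).map fun w => (w, g (relayInput h₁ w)) :=
  Measure.compProd_deterministic (hg.comp (measurable_relayInput h₁ n))

lemma ae_seqV_deterministic (h₁ : ℝ) {n : ℕ} {g : Seq n → Seq n} (hg : Measurable g) :
    ∀ᵐ ω ∂(networkLaw h₁ (Kernel.deterministic g hg)), seqV ω = g (seqU h₁ ω) := by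
  have hrelay := measurable_relayInput h₁ n
  have hset : MeasurableSet {ω : Primitive n × Seq n | seqV ω = g (seqU h₁ ω)} :=
    measurableSet_eq_fun (measurable_seqV n) (hg.comp (measurable_seqU h₁ n))
  rw [networkLaw_deterministic, ae_map_iff (by fun_prop) hset]
  exact ae_of_all _ fun w => rfl

instance : symbolLaw.IsNegInvariant := by
  refine ⟨?_⟩
  rw [Measure.neg, symbolLaw, Measure.map_smul, Measure.map_add _ _ measurable_neg,
    Measure.map_dirac' measurable_neg, Measure.map_dirac' measurable_neg, neg_neg, add_comm]

instance (v : NNReal) : (gaussianReal 0 v).IsNegInvariant :=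
  ⟨by rw [Measure.neg, gaussianReal_map_neg, neg_zero]⟩

/- If `h₁ = 0`, reverse the noise of the relay; if `h₃ = 0`, reverse the symbols as well. -/
lemma exists_reflection (h₂ : ℝ) {h₁ h₃ : ℝ} (h : h₁ = 0 ∨ h₃ = 0) (n : ℕ) :
    ∃ σ : Primitive n → Primitive n, MeasurePreserving σ (primitiveLaw n) (primitiveLaw n) ∧
      ∀ w, relayInput h₁ (σ w) = -relayInput h₁ w ∧
        ∀ v, seqX h₃ (σ w, v) = seqX h₃ (w, v) ∧ seqY h₂ (σ w, v) = seqY h₂ (w, v) := by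
  have hs := Measure.measurePreserving_neg (Measure.pi fun _ : Fin n => symbolLaw)
  have hz := Measure.measurePreserving_neg (Measure.pi fun _ : Fin n => gaussianReal 0 1)
  rcases h with rfl | rfl
  · refine ⟨_, (MeasurePreserving.id _).prod (hz.prod (MeasurePreserving.id _)),
      fun w => ⟨funext fun l => ?_, fun v => ⟨rfl, rfl⟩⟩⟩
    simp [relayInput]
  · refine ⟨_, hs.prod (hz.prod (MeasurePreserving.id _)),
      fun w => ⟨funext fun l => ?_, fun v => ⟨funext fun l => ?_, rfl⟩⟩⟩
    · simp only [relayInput, Prod.map_fst, Prod.map_snd, Pi.neg_apply]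
      ring
    · simp [seqX]

lemma map_received_reversal {h₁ h₂ h₃ : ℝ} (h : h₁ = 0 ∨ h₂ = 0 ∨ h₃ = 0) (n : ℕ) :
    (networkLaw h₁ (reversal n)).map (fun ω => (seqX h₃ ω, seqY h₂ ω)) =
      (networkLaw h₁ (faithful n)).map fun ω => (seqX h₃ ω, seqY h₂ ω) := by
  have hrelay := measurable_relayInput h₁ n
  rw [reversal, faithful, networkLaw_deterministic, networkLaw_deterministic,
    Measure.map_map (by fun_prop) (by fun_prop), Measure.map_map (by fun_prop) (by fun_prop)]
  rcases or_left_comm.1 h with rfl | h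
  · congr 1
    funext w
    exact Prod.ext rfl (funext fun l => by simp only [Function.comp_apply, seqY, zero_mul])
  obtain ⟨σ, hσ, hrefl⟩ := exists_reflection h₂ h n
  nth_rewrite 2 [← hσ.map_eq]
  rw [Measure.map_map (by fun_prop) hσ.measurable]
  congr 1
  funext w
  simp only [Function.comp_apply, (hrefl w).1, ((hrefl w).2 _).1, ((hrefl w).2 _).2]

section Decision

variable {n : ℕ} {D : Seq n → Seq n → ℝ}

lemma measurableSet_lt_decision (hD : Measurable (Function.uncurry D)) (h₂ h₃ c : ℝ) :
    MeasurableSet {ω : Primitive n × Seq n | c < D (seqX h₃ ω) (seqY h₂ ω)} :=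
  measurableSet_lt measurable_const
    (hD.comp (f := fun ω => (seqX h₃ ω, seqY h₂ ω)) (by fun_prop))

lemma networkLaw_reversal_lt_decision (hD : Measurable (Function.uncurry D)) {h₁ h₂ h₃ : ℝ}
    (h : h₁ = 0 ∨ h₂ = 0 ∨ h₃ = 0) (c : ℝ) :
    networkLaw h₁ (reversal n) {ω | c < D (seqX h₃ ω) (seqY h₂ ω)} =
      networkLaw h₁ (faithful n) {ω | c < D (seqX h₃ ω) (seqY h₂ ω)} := by
  have hreceived : Measurable fun ω : Primitive n × Seq n => (seqX h₃ ω, seqY h₂ ω) := by fun_prop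
  have hset : MeasurableSet {p | c < Function.uncurry D p} := measurableSet_lt measurable_const hD
  have hlaw := congrArg (· {p | c < Function.uncurry D p}) (map_received_reversal h n)
  simpa only [Measure.map_apply hreceived hset, Set.preimage_ofPred_eq,
    Function.uncurry_apply_pair] using hlaw

end Decision

section Deviation

variable {Q : QuantScheme} {n' n : ℕ}

lemma jointCount_eq_count {A B : Set ℝ} {u v : Seq n} (h : ∀ l, u l ∈ A → v l ∈ B) :
    jointCount A B u v = count A u := by
  refine Finset.sum_congr rfl fun l _ => ?_
  by_cases hl : u l ∈ A
  · simp [hl, h l hl]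
  · simp [hl]

lemma abs_empKernel_sub_idKernel_le_deviation (u v : Seq n) (i : Fin n') (j : Fin (Q.nv n')) :
    |empKernel Q n' u v i j - idKernel Q n' i j| ≤ deviation Q n' u v :=
  (Finset.single_le_sum (f := fun i => |empKernel Q n' u v i j - idKernel Q n' i j|)
    (fun _ _ => abs_nonneg _) (Finset.mem_univ i)).trans
  (Finset.single_le_sum (f := fun j => ∑ i, |empKernel Q n' u v i j - idKernel Q n' i j|)
    (fun _ _ => Finset.sum_nonneg fun _ _ => abs_nonneg _) (Finset.mem_univ j))

lemma deviation_self (hQ : Q.Regular n') {u : Seq n} (hu : ∀ i, count (Q.cellU n' i) u ≠ 0) :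
    deviation Q n' u u = 0 := by
  refine Finset.sum_eq_zero fun j _ => Finset.sum_eq_zero fun i _ => ?_
  have hstay : jointCount (Q.cellU n' i) (Q.cellU n' i)ᶜ u u = 0 := by
    have := jointCount_add_jointCount_compl (Q.cellU n' i) (Q.cellU n' i) u u
    rwa [jointCount_eq_count fun l hl => hl, add_eq_left] at this
  have hle := abs_empKernel_sub_idKernel_mul_count_le hQ u u i j
  rw [hstay] at hle
  exact le_antisymm (nonpos_of_mul_nonpos_left hle ((count_nonneg _ _).lt_of_ne' (hu i)))
    (abs_nonneg _)

/- A large cell of inputs is nested in the last output cell `(β₂, ∞)`, which reversal avoids. -/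
lemma one_le_deviation_neg (hQ : Q.Regular n') (hβ : 0 < Q.β₂ n') {u : Seq n}
    (hu : ∀ i, count (Q.cellU n' i) u ≠ 0) : 1 ≤ deviation Q n' u (-u) := by
  have hnv := hQ.three_le_nv
  obtain ⟨i, hi⟩ := exists_mem_cell hQ.lt₁ hQ.three_le (Q.β₂ n' + 1)
  obtain ⟨j, hj⟩ : ∃ j, Q.cellV n' j = Set.Ioi (Q.β₂ n') := by
    refine ⟨⟨Q.nv n' - 1, by omega⟩, ?_⟩
    rw [QuantScheme.cellV, cell, if_neg (by simp only; omega), if_pos (by simp only; omega)]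
  have hsub : Q.cellU n' i ⊆ Q.cellV n' j := (hQ.nested i j).resolve_right fun hd =>
    Set.disjoint_left.1 hd hi (hj.symm.subset (Set.mem_Ioi.2 (lt_add_one _)))
  have havoid : jointCount (Q.cellU n' i) (Q.cellV n' j)ᶜ u (-u) = count (Q.cellU n' i) u := by
    refine jointCount_eq_count fun l hl => ?_
    have hl' : Q.β₂ n' < u l := hj.subset (hsub hl)
    rw [hj, Set.compl_Ioi, Set.mem_Iic, Pi.neg_apply]
    linarith
  have hone : |empKernel Q n' u (-u) i j - idKernel Q n' i j| = 1 := by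
    rw [← mul_eq_right₀ (hu i), abs_empKernel_sub_idKernel_mul_count_of_subset u (-u) hsub, havoid]
  exact hone.symm.trans_le (abs_empKernel_sub_idKernel_le_deviation u (-u) i j)

lemma tendsto_unvisited (hQ : Q.Regular n') (h₁ : ℝ)
    (K : ∀ n : ℕ, Kernel (Seq n) (Seq n)) [∀ n, IsMarkovKernel (K n)] :
    Tendsto (fun n => networkLaw h₁ (K n)
      (⋃ i, {ω | count (Q.cellU n' i) (seqU h₁ ω) = 0})) atTop (𝓝 0) := by
  have hcell := VanishesInProb.iUnion
    (fun i => vanishesInProb_count h₁ (Q.measurableSet_cellU n' i) K) (hQ.obsLaw_cellU_pos h₁)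
  refine tendsto_of_tendsto_of_tendsto_of_le_of_le tendsto_const_nhds hcell (fun n => zero_le)
    fun n => measure_mono (Set.iUnion_mono fun i ω hω => ?_)
  rw [Set.mem_ofPred_eq] at hω ⊢
  rw [hω, zero_div, zero_sub, abs_neg]
  exact le_abs_self _

lemma tendsto_faithful_deviation (hQ : Q.Regular n') (h₁ : ℝ) {δ : ℝ} (hδ : 0 < δ) :
    Tendsto (fun n => networkLaw h₁ (faithful n) {ω | R Q h₁ n' ω < δ}ᶜ) atTop (𝓝 0) := by
  refine tendsto_of_tendsto_of_tendsto_of_le_of_le tendsto_const_nhds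
    (tendsto_unvisited hQ h₁ faithful) (fun n => zero_le) fun n => measure_mono_ae ?_
  filter_upwards [ae_seqV_deterministic h₁ (n := n) (g := fun u => u) measurable_id] with ω hω hR
  by_contra hunvisited
  have hvisit : ∀ i, count (Q.cellU n' i) (seqU h₁ ω) ≠ 0 := fun i hi =>
    hunvisited (Set.mem_iUnion.2 ⟨i, hi⟩)
  refine hR ?_
  rw [Set.mem_ofPred_eq, R, hω, deviation_self hQ hvisit]
  exact hδ

lemma tendsto_reversal_deviation (hQ : Q.Regular n') (hβ : 0 < Q.β₂ n') (h₁ : ℝ) {δ : ℝ}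
    (hδ : δ < 1) :
    Tendsto (fun n => networkLaw h₁ (reversal n) {ω | δ < R Q h₁ n' ω}ᶜ) atTop (𝓝 0) := by
  refine tendsto_of_tendsto_of_tendsto_of_le_of_le tendsto_const_nhds
    (tendsto_unvisited hQ h₁ reversal) (fun n => zero_le) fun n => measure_mono_ae ?_
  filter_upwards [ae_seqV_deterministic h₁ (n := n) (g := fun u => -u) measurable_neg] with ω hω hR
  by_contra hunvisited
  have hvisit : ∀ i, count (Q.cellU n' i) (seqU h₁ ω) ≠ 0 := fun i hi =>
    hunvisited (Set.mem_iUnion.2 ⟨i, hi⟩)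
  refine hR ?_
  rw [Set.mem_ofPred_eq, R, hω]
  exact hδ.trans_le (one_le_deviation_neg hQ hβ hvisit)

end Deviation

lemma measureReal_le_compl_add_cond {Ω : Type*} [MeasurableSpace Ω] (μ : Measure Ω)
    [IsProbabilityMeasure μ] {A : Set Ω} (hA : MeasurableSet A) (T : Set Ω) :
    μ.real T ≤ μ.real Aᶜ + (cond μ A).real T := by
  have hinter : μ.real (A ∩ T) ≤ (cond μ A).real T := by
    rw [measureReal_def, measureReal_def, ← cond_mul_eq_inter hA, ENNReal.toReal_mul]
    exact mul_le_of_le_one_right ENNReal.toReal_nonneg measureReal_le_one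
  calc μ.real T ≤ μ.real (Aᶜ ∪ A ∩ T) := measureReal_mono fun ω hω => by
        by_cases hωA : ω ∈ A
        exacts [Or.inr ⟨hωA, hω⟩, Or.inl hωA]
    _ ≤ μ.real Aᶜ + (cond μ A).real T := (measureReal_union_le _ _).trans (by gcongr)

lemma liminf_pos_of_tendsto_compl {ι : Type*} {l : Filter ι} [l.NeBot] {Ω : ι → Type*}
    [∀ n, MeasurableSpace (Ω n)] (μ : ∀ n, Measure (Ω n)) [∀ n, IsProbabilityMeasure (μ n)]
    {A : ∀ n, Set (Ω n)} (hA : ∀ n, MeasurableSet (A n))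
    (h : Tendsto (fun n => μ n (A n)ᶜ) l (𝓝 0)) : 0 < liminf (fun n => μ n (A n)) l := by
  have hone := ENNReal.Tendsto.sub tendsto_const_nhds h (Or.inl ENNReal.one_ne_top)
  simp only [← prob_compl_eq_one_sub (hA _).compl, compl_compl, tsub_zero] at hone
  exact hone.liminf_eq ▸ zero_lt_one

/-! ### Detectors -/

/-- The statistics `D` detect attacks, with false-alarm level `μ'`. -/
def Detects (h₁ h₂ h₃ : ℝ) (Q : QuantScheme) (D : ∀ n : ℕ, Seq n → Seq n → ℝ)
    (μ' : ℕ → ℝ → ℝ) : Prop :=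
  ∀ η : ℝ, 0 < η → ∃ thr : ℕ → ℝ → ℝ,
    (∀ n' δ, 0 < δ → 0 < thr n' δ ∧ thr n' δ < η) ∧
    ∃ δ₀ > (0 : ℝ), ∃ ε₀ > (0 : ℝ),
      ∀ δ : ℝ, 0 < δ → δ < δ₀ → ∀ ε : ℝ, 0 < ε → ε < ε₀ →
      ∃ N : ℕ, ∀ n' ≥ N,
      ∀ K : ∀ n : ℕ, Kernel (Seq n) (Seq n), (∀ n, IsMarkovKernel (K n)) →
        (0 < liminf (fun n => networkLaw h₁ (K n) {ω | δ < R Q h₁ n' ω}) atTop →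
          ∃ L : ℝ, 1 - ε ≤ L ∧
            Tendsto (fun n => (cond (networkLaw h₁ (K n)) {ω | δ < R Q h₁ n' ω}).real
              {ω | thr n' δ < D n (seqX h₃ ω) (seqY h₂ ω)}) atTop (𝓝 L)) ∧
        (0 < liminf (fun n => networkLaw h₁ (K n) {ω | R Q h₁ n' ω < δ}) atTop →
          ∃ L : ℝ, L ≤ ε ∧
            Tendsto (fun n => (cond (networkLaw h₁ (K n)) {ω | R Q h₁ n' ω ≤ δ}).real
              {ω | μ' n' δ < D n (seqX h₃ ω) (seqY h₂ ω)}) atTop (𝓝 L))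

section Detects

variable {h₁ h₂ h₃ : ℝ} {Q : QuantScheme} {D : ∀ n : ℕ, Seq n → Seq n → ℝ} {μ' : ℕ → ℝ → ℝ}

lemma detects_statistic (Q : QuantScheme) (hh₁ : h₁ ≠ 0) (hh₂ : h₂ ≠ 0) (hh₃ : h₃ ≠ 0) :
    Detects h₁ h₂ h₃ Q (statistic h₁ h₂ h₃) (faithfulBound h₁ h₂ Q) := by
  intro η hη
  have hthr : ∀ n' δ, ∃ τ, 0 < δ → (0 < τ ∧ τ < η) ∧ (Q.Regular n' →
      ∀ K : ∀ n : ℕ, Kernel (Seq n) (Seq n), (∀ n, IsMarkovKernel (K n)) →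
      Tendsto (fun n => networkLaw h₁ (K n) ({ω | δ < R Q h₁ n' ω} ∩
        {ω | τ < statistic h₁ h₂ h₃ n (seqX h₃ ω) (seqY h₂ ω)}ᶜ)) atTop (𝓝 0)) := by
    intro n' δ
    by_cases h : 0 < δ ∧ Q.Regular n'
    · obtain ⟨τ, hτ, hlim⟩ := exists_threshold hh₁ hh₂ hh₃ h.2 h.1 hη
      exact ⟨τ, fun _ => ⟨hτ, fun _ => hlim⟩⟩
    · exact ⟨η / 2, fun hδ => ⟨⟨half_pos hη, half_lt_self hη⟩, fun hQ => absurd ⟨hδ, hQ⟩ h⟩⟩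
  choose thr hthr using hthr
  obtain ⟨N, hN⟩ := eventually_atTop.1 Q.eventually_regular
  refine ⟨thr, fun n' δ hδ => (hthr n' δ hδ).1, 1, one_pos, 1, one_pos, fun δ hδ _ ε hε _ =>
    ⟨N, fun n' hn' K hK => ⟨fun hpos => ⟨1, by linarith, ?_⟩, fun hpos => ⟨0, hε.le, ?_⟩⟩⟩⟩
  · exact tendsto_cond_one _
      (fun n => measurableSet_lt measurable_const (measurable_R Q h₁ n' n))
      (fun n => measurableSet_lt_decision (measurable_statistic h₁ h₂ h₃ n) _ _ _) hpos
      ((hthr n' δ hδ).2 (hN n' hn') K hK)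
  · exact tendsto_cond_zero _
      (fun n => measurableSet_le (measurable_R Q h₁ n' n) measurable_const)
      (fun n ω hω => le_of_lt (α := ℝ) hω) hpos (tendsto_falseAlarm hh₃ (hN n' hn') hδ K)

lemma Detects.exists_tendsto_cond_faithful (hdet : Detects h₁ h₂ h₃ Q D μ')
    (hμ' : Tendsto (Function.uncurry μ') (atTop ×ˢ 𝓝[>] (0 : ℝ)) (𝓝 0)) {c e : ℝ} (hc : 0 < c)
    (he : 0 < e) :
    ∃ n' δ, (Q.Regular n' ∧ 0 < δ ∧ μ' n' δ < c) ∧ ∃ L < e,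
      Tendsto (fun n => (cond (networkLaw h₁ (faithful n)) {ω | R Q h₁ n' ω ≤ δ}).real
        {ω | μ' n' δ < D n (seqX h₃ ω) (seqY h₂ ω)}) atTop (𝓝 L) := by
  obtain ⟨thr, -, δ₀, hδ₀, ε₀, hε₀, hall⟩ := hdet 1 one_pos
  obtain ⟨ε, hε, hεlt⟩ := exists_between (lt_min he hε₀)
  obtain ⟨hεe, hεε₀⟩ := lt_min_iff.1 hεlt
  obtain ⟨P, hP, S, hS, hPS⟩ := eventually_prod_iff.1 (hμ'.eventually_lt_const hc)
  have hδsmall : ∀ᶠ δ in 𝓝[>] (0 : ℝ), δ < δ₀ := nhdsWithin_le_nhds (eventually_lt_nhds hδ₀)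
  obtain ⟨δ, hδS, hδδ₀, hδ⟩ := (hS.and (hδsmall.and self_mem_nhdsWithin)).exists
  obtain ⟨N, hN⟩ := hall δ hδ hδδ₀ ε hε hεε₀
  obtain ⟨n', hn'P, hQ, hn'N⟩ :=
    (hP.and (Q.eventually_regular.and (eventually_ge_atTop N))).exists
  obtain ⟨L, hL, hlim⟩ := (hN n' hn'N faithful inferInstance).2
    (liminf_pos_of_tendsto_compl _
      (fun n => measurableSet_lt (measurable_R Q h₁ n' n) measurable_const)
      (tendsto_faithful_deviation hQ h₁ hδ))
  exact ⟨n', δ, ⟨hQ, hδ, hPS hn'P hδS⟩, L, hL.trans_lt hεe, hlim⟩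

lemma Detects.tendsto_faithful (hdet : Detects h₁ h₂ h₃ Q D μ')
    (hμ' : Tendsto (Function.uncurry μ') (atTop ×ˢ 𝓝[>] (0 : ℝ)) (𝓝 0)) {c : ℝ} (hc : 0 < c) :
    Tendsto (fun n => networkLaw h₁ (faithful n) {ω | c < D n (seqX h₃ ω) (seqY h₂ ω)})
      atTop (𝓝 0) := by
  suffices hreal : Tendsto (fun n => (networkLaw h₁ (faithful n)).real
      {ω | c < D n (seqX h₃ ω) (seqY h₂ ω)}) atTop (𝓝 0) by
    simpa using ENNReal.tendsto_ofReal hreal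
  refine tendsto_order.2 ⟨fun a ha => Eventually.of_forall fun n =>
    ha.trans_le measureReal_nonneg, fun e he => ?_⟩
  obtain ⟨n', δ, ⟨hQ, hδ, hμc⟩, L, hL, hlim⟩ := hdet.exists_tendsto_cond_faithful hμ' hc he
  have hdev := (ENNReal.tendsto_toReal ENNReal.zero_ne_top).comp
    (tendsto_faithful_deviation hQ h₁ hδ)
  rw [ENNReal.toReal_zero] at hdev
  filter_upwards [(hdev.add hlim).eventually_lt_const (by rwa [zero_add])] with n hn
  set P := networkLaw h₁ (faithful n)
  calc P.real {ω | c < D n (seqX h₃ ω) (seqY h₂ ω)}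
      ≤ P.real {ω | μ' n' δ < D n (seqX h₃ ω) (seqY h₂ ω)} :=
        measureReal_mono fun ω hω => hμc.trans hω
    _ ≤ P.real {ω | R Q h₁ n' ω ≤ δ}ᶜ + _ := measureReal_le_compl_add_cond P
        (measurableSet_le (measurable_R Q h₁ n' n) measurable_const) _
    _ ≤ P.real {ω | R Q h₁ n' ω < δ}ᶜ + _ := add_le_add
        (measureReal_mono fun ω hω hR => hω (le_of_lt (α := ℝ) hR)) le_rfl
    _ < e := hn

lemma not_detects_of_eq_zero (Q : QuantScheme) (h : h₁ = 0 ∨ h₂ = 0 ∨ h₃ = 0)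
    (hD : ∀ n, Measurable (Function.uncurry (D n)))
    (hμ' : Tendsto (Function.uncurry μ') (atTop ×ˢ 𝓝[>] (0 : ℝ)) (𝓝 0)) :
    ¬ Detects h₁ h₂ h₃ Q D μ' := by
  intro hdet
  obtain ⟨thr, hthr, δ₀, hδ₀, ε₀, hε₀, hall⟩ := hdet 1 one_pos
  obtain ⟨δ, hδ, hδlt⟩ := exists_between (lt_min hδ₀ one_pos)
  obtain ⟨ε, hε, hεlt⟩ := exists_between (lt_min hε₀ one_pos)
  obtain ⟨hδδ₀, hδ1⟩ := lt_min_iff.1 hδlt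
  obtain ⟨hεε₀, hε1⟩ := lt_min_iff.1 hεlt
  obtain ⟨N, hN⟩ := hall δ hδ hδδ₀ ε hε hεε₀
  obtain ⟨n', hQ, hβ, hn'⟩ := (Q.eventually_regular.and
    ((Q.tendsto_β₂.eventually_gt_atTop 0).and (eventually_ge_atTop N))).exists
  have hmeas : ∀ n, MeasurableSet {ω : Primitive n × Seq n | δ < R Q h₁ n' ω} := fun n =>
    measurableSet_lt measurable_const (measurable_R Q h₁ n' n)
  have hpos := liminf_pos_of_tendsto_compl _ hmeas (tendsto_reversal_deviation hQ hβ h₁ hδ1)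
  obtain ⟨L, hL, hdetect⟩ := (hN n' hn' reversal inferInstance).1 hpos
  have hsilent : Tendsto (fun n => networkLaw h₁ (reversal n)
      {ω | thr n' δ < D n (seqX h₃ ω) (seqY h₂ ω)}) atTop (𝓝 0) := by
    simp only [networkLaw_reversal_lt_decision (hD _) h]
    exact hdet.tendsto_faithful hμ' (hthr n' δ hδ).1
  have hL0 : L = 0 := tendsto_nhds_unique hdetect <|
    tendsto_cond_zero _ hmeas (fun n => subset_rfl) hpos <|
      tendsto_of_tendsto_of_tendsto_of_le_of_le tendsto_const_nhds hsilent (fun n => zero_le)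
        fun n => measure_mono Set.inter_subset_right
  linarith

end Detects

end RelayNetwork

end

theorem theorem1 (h₁ h₂ h₃ : ℝ) (Q : RelayNetwork.QuantScheme) :
    RelayNetwork.NonManipulable h₁ h₂ h₃ ↔
      ∃ D : ∀ n : ℕ, RelayNetwork.Seq n → RelayNetwork.Seq n → ℝ,
        (∀ n, Measurable (Function.uncurry (D n))) ∧
        ∃ μ' : ℕ → ℝ → ℝ,
          Tendsto (Function.uncurry μ') (atTop ×ˢ 𝓝[>] (0 : ℝ)) (𝓝 0) ∧
          ∀ η : ℝ, 0 < η → ∃ thr : ℕ → ℝ → ℝ,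
            (∀ n' δ, 0 < δ → 0 < thr n' δ ∧ thr n' δ < η) ∧
            ∃ δ₀ > (0 : ℝ), ∃ ε₀ > (0 : ℝ),
              ∀ δ : ℝ, 0 < δ → δ < δ₀ → ∀ ε : ℝ, 0 < ε → ε < ε₀ →
              ∃ N : ℕ, ∀ n' ≥ N,
              ∀ K : ∀ n : ℕ, Kernel (RelayNetwork.Seq n) (RelayNetwork.Seq n),
                (∀ n, IsMarkovKernel (K n)) →
                (0 < liminf (fun n => RelayNetwork.networkLaw h₁ (K n)
                      {ω | δ < RelayNetwork.R Q h₁ n' ω}) atTop →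
                  ∃ L : ℝ, 1 - ε ≤ L ∧
                    Tendsto (fun n =>
                      (cond (RelayNetwork.networkLaw h₁ (K n))
                        {ω | δ < RelayNetwork.R Q h₁ n' ω}).real
                        {ω | thr n' δ < D n (RelayNetwork.seqX h₃ ω) (RelayNetwork.seqY h₂ ω)})
                      atTop (𝓝 L)) ∧
                (0 < liminf (fun n => RelayNetwork.networkLaw h₁ (K n)
                      {ω | RelayNetwork.R Q h₁ n' ω < δ}) atTop →
                  ∃ L : ℝ, L ≤ ε ∧
                    Tendsto (fun n =>
                      (cond (RelayNetwork.networkLaw h₁ (K n))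
                        {ω | RelayNetwork.R Q h₁ n' ω ≤ δ}).real
                        {ω | μ' n' δ < D n (RelayNetwork.seqX h₃ ω) (RelayNetwork.seqY h₂ ω)})
                      atTop (𝓝 L)) := by
  rw [RelayNetwork.nonManipulable_iff]
  constructor
  · rintro ⟨hh₁, hh₂, hh₃⟩
    exact ⟨RelayNetwork.statistic h₁ h₂ h₃, RelayNetwork.measurable_statistic h₁ h₂ h₃,
      RelayNetwork.faithfulBound h₁ h₂ Q, RelayNetwork.tendsto_faithfulBound h₁ h₂ Q,
      RelayNetwork.detects_statistic Q hh₁ hh₂ hh₃⟩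
  · rintro ⟨D, hD, μ', hμ', hdet⟩
    by_contra hzero
    exact RelayNetwork.not_detects_of_eq_zero Q (by tauto) hD hμ' hdet
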